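/- Let $k\ge 3$. A convex $k$-gon is the closed polygonal curve in $\mathbb R^2$ formed by the $k$ edges of the convex hull of $k$ points in convex position (so each of the $k$ points is a vertex of the hull). For $n\ge 0$ let $a_{k\mathsf P}(n)$ be the maximum, over all choices of $n$ convex $k$-gons $P_1,\dots,P_n$ in the plane, of the number of regions, i.e. of connected components of $\mathbb R^2\setminus(P_1\cup\dots\cup P_n)$. Then this maximum exists, and $$a_{k\mathsf P}(n)=kn^2-kn+2\quad(n\ge 1),\qquad a_{k\mathsf P}(0)=1 .$$ Moreover, the maximum has the same value if $P_1,\dots,P_n$ are only allowed to be images of a regular $k$-gon under invertible affine maps of the plane. -/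

import Mathlib

/-- The Euclidean plane. -/
abbrev Plane : Type := EuclideanSpace ℝ (Fin 2)

/-- The polygon `p`, with its vertices listed in cyclic order, is a convex `k`-gon: its `k` vertices
are in convex position (each of them is a corner), and its edges trace the boundary of their convex
hull. -/
def IsConvexPolygon {k : ℕ} (p : Polygon Plane k) : Prop :=
  ConvexIndependent ℝ p.vertices ∧
    p.boundary ℝ = frontier (convexHull ℝ (Set.range p.vertices))

/-- The family of all convex `k`-gons, each regarded as a closed curve (the union of its edges). -/
def convexPolygonCurves (k : ℕ) : Set (Set Plane) :=
  {c | ∃ p : Polygon Plane k, IsConvexPolygon p ∧ c = p.boundary ℝ}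

/-- The regular `k`-gon inscribed in the unit circle. -/
noncomputable def regularPolygon (k : ℕ) : Polygon Plane k where
  vertices j := !₂[Real.cos (2 * Real.pi * (j : ℕ) / k), Real.sin (2 * Real.pi * (j : ℕ) / k)]

/-- The family of all images of a shape under the affine group of the plane. -/
def affineImages (s : Set Plane) : Set (Set Plane) :=
  {c | ∃ T : Plane ≃ᵃ[ℝ] Plane, c = T '' s}

/-- The number of regions into which the drawing `U` divides the plane: the number of connected
components of the complement of `U`. -/
noncomputable def numRegions (U : Set Plane) : ℕ∞ :=
  ENat.card (ConnectedComponents (Uᶜ : Set Plane))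

/-- All the numbers of regions that are formed by drawings of `n` members of the family `S`. -/
def regionNumbers (S : Set (Set Plane)) (n : ℕ) : Set ℕ∞ :=
  {r | ∃ c : Fin n → Set Plane, (∀ i, c i ∈ S) ∧ r = numRegions (⋃ i, c i)}

/-! Upper bound: the regions of an open set are counted by the dimension of its space of locally
constant functions, extended by zero. When the boundary of a convex body $K$ is added, such a
function has a jump across each boundary point still in the open set, and a function without jumps
extends across that boundary. The jump vanishes on a clopen part of the boundary, so the dimension
grows by at most the number of test points needed to reach every arc
(`rank_locConstOn_diff_frontier_le`). A new polygon meeting the drawing needs one test point per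
entrance into an older curve. Each of its $k$ edges enters each of the $n$ older convex curves at
most twice, so $2kn$ points suffice (`rank_locConstOn_diff_polygon_le`). The first polygon adds 1,
and summation gives $2+kn(n-1)$. No general position or Euler formula is needed.

Lower bound: take $n$ copies of the regular $k$-gon turned by multiples of $2\pi/(kn)$. To a point
strictly inside some copy, assign the set of edge lines separating it from the centre; all other
points get one common value. This signature is locally constant off the drawing
(`eventually_spreadSignature_eq`), because a point on an edge line but off the drawing lies outside
all copies. Every cyclic block of $m$ consecutive lines, $1\le m\le n-1$, is realised. Together with
the centre and a far point this gives $kn(n-1)+2$ values. These copies are affine images of one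
regular polygon, so both families have the same maximum. -/

open Set Filter Topology

/-! ### Locally constant functions and connected components -/

/-- The functions with values in `F` that are locally constant on `W` and vanish off `W`. -/
def locConstOn (F : Type) [Field F] {X : Type} [TopologicalSpace X] (W : Set X) :
    Submodule F (X → F) where
  carrier := {f | (∀ x ∈ W, ∀ᶠ y in 𝓝 x, f y = f x) ∧ ∀ x ∉ W, f x = 0}
  add_mem' := by
    rintro f g ⟨hf, hf'⟩ ⟨hg, hg'⟩
    refine ⟨fun x hx => ?_, fun x hx => by simp [hf' x hx, hg' x hx]⟩
    filter_upwards [hf x hx, hg x hx] with y h₁ h₂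
    simp [h₁, h₂]
  zero_mem' := ⟨fun x _ => by simp, fun x _ => rfl⟩
  smul_mem' := by
    rintro c f ⟨hf, hf'⟩
    refine ⟨fun x hx => ?_, fun x hx => by simp [hf' x hx]⟩
    filter_upwards [hf x hx] with y h₁
    simp [h₁]

lemma IsPreconnected.eq_of_eventually_eq {X Y : Type*} [TopologicalSpace X] {s : Set X}
    (hs : IsPreconnected s) {f : X → Y} (hf : ∀ x ∈ s, ∀ᶠ y in 𝓝[s] x, f y = f x)
    {x y : X} (hx : x ∈ s) (hy : y ∈ s) : f x = f y := by
  let _ : TopologicalSpace Y := ⊥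
  have : DiscreteTopology Y := ⟨rfl⟩
  refine hs.constant (f := f) (fun z hz => ?_) hx hy
  rw [ContinuousWithinAt, nhds_discrete, tendsto_pure]
  exact hf z hz

lemma locConstOn_eq_of_isPreconnected {F : Type} [Field F] {X : Type} [TopologicalSpace X]
    {W s : Set X} {f : X → F} (hf : f ∈ locConstOn F W) (hs : IsPreconnected s) (hsW : s ⊆ W)
    {x y : X} (hx : x ∈ s) (hy : y ∈ s) : f x = f y :=
  hs.eq_of_eventually_eq (fun z hz => nhdsWithin_le_nhds (hf.1 z (hsW hz))) hx hy

/-- An open set of a locally connected space has at most as many components as the dimension of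
its space of locally constant functions. -/
lemma card_connectedComponents_le_rank_locConstOn (F : Type) [Field F] {X : Type}
    [TopologicalSpace X] [LocallyConnectedSpace X] {W : Set X} (hW : IsOpen W) {N : ℕ}
    (h : Module.rank F (locConstOn F W) ≤ N) : ENat.card (ConnectedComponents W) ≤ N := by
  classical
  have : LocallyConnectedSpace W := hW.locallyConnectedSpace
  -- Indicators of components, extended by zero; they are locally constant on `W` because components
  -- of an open set are open here.
  let g : ConnectedComponents W → X → F := fun c x =>
    if hx : x ∈ W then (if ConnectedComponents.mk (⟨x, hx⟩ : W) = c then 1 else 0) else 0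
  have hg : ∀ c, g c ∈ locConstOn F W := by
    intro c
    refine ⟨fun x hx => ?_, fun x hx => by simp [g, hx]⟩
    have h1 : ∀ᶠ y : W in 𝓝 (⟨x, hx⟩ : W),
        ConnectedComponents.mk y = ConnectedComponents.mk (⟨x, hx⟩ : W) :=
      ConnectedComponents.continuous_coe.continuousAt.eventually_mem
        ((isOpen_discrete {ConnectedComponents.mk (⟨x, hx⟩ : W)}).mem_nhds rfl)
    have h2 := hW.isOpenEmbedding_subtypeVal.map_nhds_eq ⟨x, hx⟩
    rw [← show map Subtype.val (𝓝 (⟨x, hx⟩ : W)) = 𝓝 x from h2, eventually_map]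
    filter_upwards [h1] with y hy
    simp [g, hx, hy]
  let G : ConnectedComponents W → locConstOn F W := fun c => ⟨g c, hg c⟩
  have hli : LinearIndependent F G := by
    rw [linearIndependent_iff']
    intro s a hs c hc
    obtain ⟨x, rfl⟩ := ConnectedComponents.surjective_coe c
    have := congrFun (congrArg Subtype.val hs) x.1
    simpa [G, g, hc] using this
  have := hli.cardinal_le_rank
  rw [ENat.card, Cardinal.toENat_le_natCast]
  exact this.trans h

/-! ### Crossing the boundary of a convex body -/

/-- Pushing away from an interior point `p` never brings points near `x` into `K`. Short parallel
segments therefore join all nearby outside points to one small ball around `x + s₀ • d` that misses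
`K`. -/
lemma Convex.exists_isPreconnected_compl_mem_nhdsWithin {E : Type} [NormedAddCommGroup E]
    [NormedSpace ℝ E] {K O : Set E} (hK : Convex ℝ K) (hc : IsClosed K)
    (hi : (interior K).Nonempty) {x : E} (hx : x ∈ frontier K) (hO : O ∈ 𝓝 x) :
    ∃ W ⊆ O \ K, IsPreconnected W ∧ W.Nonempty ∧ W ∈ 𝓝[Kᶜ] x := by
  obtain ⟨p, hp⟩ := hi
  obtain ⟨η, hη, hpK⟩ := Metric.isOpen_iff.1 isOpen_interior p hp
  obtain ⟨ε, hε, hxO⟩ := Metric.mem_nhds_iff.1 hO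
  set d := x - p with hd
  -- moving away from `p` keeps points near `x` outside `K`
  have key : ∀ y, ∀ s ∈ Icc (0 : ℝ) 1, y + s • d ∈ Metric.ball x η → y + s • d ∈ K → y ∈ K := by
    intro y s hs hq hqK
    have h1 : y + s • d - d ∈ K := by
      refine interior_subset (hpK ?_)
      rw [Metric.mem_ball, dist_eq_norm] at hq ⊢
      convert hq using 2
      rw [hd]; abel
    have := hK hqK h1 (sub_nonneg.2 hs.2) hs.1 (by ring)
    convert this using 1
    module
  obtain ⟨s₀, hs₀, hs₁, hs₂⟩ : ∃ s₀ : ℝ, 0 < s₀ ∧ s₀ ≤ 1 ∧ s₀ * ‖d‖ < min ε η / 2 := by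
    refine ⟨min 1 (min ε η / 2 / (‖d‖ + 1)), by positivity, min_le_left _ _, ?_⟩
    have h1 : min 1 (min ε η / 2 / (‖d‖ + 1)) ≤ min ε η / 2 / (‖d‖ + 1) := min_le_right _ _
    have h2 : 0 < min ε η / 2 := by positivity
    calc _ ≤ min ε η / 2 / (‖d‖ + 1) * ‖d‖ := by gcongr
      _ < _ := by
        rw [div_mul_eq_mul_div, div_lt_iff₀ (by positivity)]
        nlinarith [norm_nonneg d]
  have hmove : ∀ y ∈ Metric.ball x (min ε η / 2), ∀ s ∈ Icc 0 s₀,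
      y + s • d ∈ Metric.ball x (min ε η) := by
    intro y hy s hs
    rw [Metric.mem_ball, dist_eq_norm] at hy ⊢
    calc ‖y + s • d - x‖ = ‖(y - x) + s • d‖ := by congr 1; abel
      _ ≤ ‖y - x‖ + ‖s • d‖ := norm_add_le _ _
      _ = ‖y - x‖ + s * ‖d‖ := by rw [norm_smul, Real.norm_of_nonneg hs.1]
      _ ≤ ‖y - x‖ + s₀ * ‖d‖ := by gcongr; exact hs.2
      _ < _ := by linarith
  -- Otherwise `x` would lie strictly between the interior point `p` and a point of `K`, hence in
  -- the interior.
  have hx' : x + s₀ • d ∉ K := by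
    intro h
    have : x ∈ interior K := by
      refine hK.openSegment_interior_self_subset_interior hp h ?_
      refine ⟨s₀ / (1 + s₀), 1 / (1 + s₀), by positivity, by positivity, by field_simp; ring, ?_⟩
      have : (1 + s₀) ≠ 0 := by positivity
      rw [hd]
      match_scalars <;> field_simp
      ring
    exact hx.2 this
  have hmin : 0 < min ε η / 2 := by positivity
  obtain ⟨r, hr, hrK⟩ := Metric.isOpen_iff.1 hc.isOpen_compl _ hx'
  set r' := min r (min ε η / 2) with hr'
  have hr'0 : 0 < r' := by positivity
  have hsub : Metric.ball x r' ⊆ Metric.ball x (min ε η / 2) :=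
    Metric.ball_subset_ball (min_le_right _ _)
  have hbε : Metric.ball x (min ε η) ⊆ O :=
    (Metric.ball_subset_ball (min_le_left _ _)).trans hxO
  have hbη : Metric.ball x (min ε η) ⊆ Metric.ball x η :=
    (Metric.ball_subset_ball (min_le_right _ _))
  have htr : ∀ y, y ∈ Metric.ball x r' → y + s₀ • d ∈ Metric.ball (x + s₀ • d) r' := by
    intro y hy
    simpa [Metric.mem_ball, dist_eq_norm] using hy
  have htr' : ∀ z ∈ Metric.ball (x + s₀ • d) r', z - s₀ • d ∈ Metric.ball x r' := by
    intro y hy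
    rw [Metric.mem_ball, dist_eq_norm] at hy ⊢
    convert hy using 2
    abel
  let S : E → Set E := fun y => (fun s : ℝ => y + s • d) '' Icc 0 s₀
  refine ⟨(⋃ y ∈ Metric.ball x r' \ K, S y ∪ Metric.ball (x + s₀ • d) r') ∪
      Metric.ball (x + s₀ • d) r', ?_, ?_, ?_, ?_⟩
  · have hB : Metric.ball (x + s₀ • d) r' ⊆ O \ K := by
      intro z hz
      refine ⟨hbε ?_, hrK (Metric.ball_subset_ball (min_le_left _ _) hz)⟩
      have := hmove _ (hsub (htr' z hz)) s₀ ⟨hs₀.le, le_rfl⟩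
      simpa using this
    refine union_subset (iUnion₂_subset fun y hy => union_subset ?_ hB) hB
    rintro _ ⟨s, hs, rfl⟩
    have h1 := hmove y (hsub hy.1) s hs
    exact ⟨hbε h1, fun h => hy.2 (key y s ⟨hs.1, hs.2.trans hs₁⟩ (hbη h1) h)⟩
  · have hB : IsPreconnected (Metric.ball (x + s₀ • d) r') := (convex_ball _ _).isPreconnected
    have hmem : x + s₀ • d ∈ Metric.ball (x + s₀ • d) r' := Metric.mem_ball_self hr'0
    have hS : ∀ y ∈ Metric.ball x r' \ K,
        IsPreconnected (S y ∪ Metric.ball (x + s₀ • d) r') := by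
      intro y hy
      refine IsPreconnected.union (y + s₀ • d) ⟨s₀, ⟨hs₀.le, le_rfl⟩, rfl⟩ (htr y hy.1) ?_ hB
      exact isPreconnected_Icc.image _ (by fun_prop)
    have : (⋃ y ∈ Metric.ball x r' \ K, S y ∪ Metric.ball (x + s₀ • d) r') ∪
        Metric.ball (x + s₀ • d) r' =
        ⋃₀ (insert (Metric.ball (x + s₀ • d) r')
          ((fun y => S y ∪ Metric.ball (x + s₀ • d) r') '' (Metric.ball x r' \ K))) := by
      rw [sUnion_insert, sUnion_image, union_comm]
    rw [this]
    refine isPreconnected_sUnion (x + s₀ • d) _ ?_ ?_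
    · rintro t (rfl | ⟨y, -, rfl⟩)
      · exact hmem
      · exact Or.inr hmem
    · rintro t (rfl | ⟨y, hy, rfl⟩)
      · exact hB
      · exact hS y hy
  · exact ⟨x + s₀ • d, Or.inr (Metric.mem_ball_self hr'0)⟩
  · rw [mem_nhdsWithin]
    refine ⟨Metric.ball x r', Metric.isOpen_ball, Metric.mem_ball_self hr'0, fun y hy => ?_⟩
    refine Or.inl (mem_iUnion₂.2 ⟨y, hy, Or.inl ⟨0, ⟨le_rfl, hs₀.le⟩, by simp⟩⟩)

lemma Convex.exists_isPreconnected_interior_mem_nhdsWithin {E : Type} [NormedAddCommGroup E]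
    [NormedSpace ℝ E] {K O : Set E} (hK : Convex ℝ K)
    (hi : (interior K).Nonempty) {x : E} (hx : x ∈ frontier K) (hO : O ∈ 𝓝 x) :
    ∃ W ⊆ O ∩ interior K, IsPreconnected W ∧ W.Nonempty ∧ W ∈ 𝓝[interior K] x := by
  obtain ⟨ε, hε, hxO⟩ := Metric.mem_nhds_iff.1 hO
  refine ⟨Metric.ball x ε ∩ interior K, inter_subset_inter_left _ hxO,
    ((convex_ball x ε).inter hK.interior).isPreconnected, ?_, ?_⟩
  · have : x ∈ closure (interior K) := by
      rw [hK.closure_interior_eq_closure_of_nonempty_interior hi]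
      exact hx.1
    exact mem_closure_iff.1 this _ Metric.isOpen_ball (Metric.mem_ball_self hε)
  · rw [inter_comm]
    exact inter_mem_nhdsWithin _ (Metric.ball_mem_nhds x hε)

/-- Removing the boundary of a convex body from an open set: the dimension of the space of locally
constant functions grows by at most the number of points that are needed to test a clopen
condition on the part of the boundary in the open set. -/
lemma rank_locConstOn_diff_frontier_le {F : Type} [Field F] {E : Type} [NormedAddCommGroup E]
    [NormedSpace ℝ E] {K O : Set E} (hK : Convex ℝ K) (hc : IsClosed K)
    (hi : (interior K).Nonempty) (hO : IsOpen O) {ι : Type} [Fintype ι] (x : ι → E)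
    (hP : ∀ P : E → Prop, (∀ y ∈ frontier K ∩ O, ∀ᶠ z in 𝓝[frontier K] y, (P z ↔ P y)) →
      (∀ i, P (x i)) → ∀ y ∈ frontier K ∩ O, P y) :
    Module.rank F (locConstOn F (O \ frontier K)) ≤
      Module.rank F (locConstOn F O) + Fintype.card ι := by
  classical
  have hcases : ∀ y, y ∉ frontier K → y ∈ interior K ∨ y ∈ Kᶜ := by
    intro y hy
    by_cases h : y ∈ K
    · left
      by_contra h'
      exact hy (hc.frontier_eq ▸ ⟨h, h'⟩)
    · exact Or.inr h
  have hopen : IsOpen (O \ frontier K) := hO.sdiff isClosed_frontier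
  have hint : ∀ y ∈ interior K, y ∉ frontier K := fun y hy h => h.2 hy
  have hext : ∀ y ∉ K, y ∉ frontier K := fun y hy h => hy (hc.frontier_subset h)
  -- The points `a`, `b` depend on `y` but not on `f`: they carry the one-sided values of every `f`
  -- at `y`, which makes the jump linear in `f`.
  have hloc : ∀ y ∈ frontier K ∩ O, ∃ a b, ∀ f ∈ locConstOn F (O \ frontier K),
      (∀ᶠ z in 𝓝 y, z ∈ interior K → f z = f a) ∧ (∀ᶠ z in 𝓝 y, z ∈ Kᶜ → f z = f b) := by
    intro y hy
    obtain ⟨W₁, hW₁, hW₁p, ⟨a, ha⟩, hW₁n⟩ :=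
      hK.exists_isPreconnected_interior_mem_nhdsWithin hi hy.1 (hO.mem_nhds hy.2)
    obtain ⟨W₂, hW₂, hW₂p, ⟨b, hb⟩, hW₂n⟩ :=
      hK.exists_isPreconnected_compl_mem_nhdsWithin hc hi hy.1 (hO.mem_nhds hy.2)
    refine ⟨a, b, fun f hf => ⟨?_, ?_⟩⟩
    · filter_upwards [mem_nhdsWithin_iff_eventually.1 hW₁n] with z hz hzK
      exact locConstOn_eq_of_isPreconnected hf hW₁p
        (fun w hw => ⟨(hW₁ hw).1, hint w (hW₁ hw).2⟩) (hz hzK) ha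
    · filter_upwards [mem_nhdsWithin_iff_eventually.1 hW₂n] with z hz hzK
      exact locConstOn_eq_of_isPreconnected hf hW₂p
        (fun w hw => ⟨(hW₂ hw).1, hext w (hW₂ hw).2⟩) (hz hzK) hb
  choose! a b hab using hloc
  let L : locConstOn F (O \ frontier K) →ₗ[F] (ι → F) :=
    { toFun := fun f i => f.1 (a (x i)) - f.1 (b (x i))
      map_add' := fun f g => by ext i; simp; ring
      map_smul' := fun c f => by ext i; simp; ring }
  let R : locConstOn F O →ₗ[F] locConstOn F (O \ frontier K) :=
    { toFun := fun f => ⟨fun y => if y ∈ frontier K then 0 else f.1 y, by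
        refine ⟨fun y hy => ?_, fun y hy => ?_⟩
        · filter_upwards [f.2.1 y hy.1, isClosed_frontier.isOpen_compl.mem_nhds hy.2] with z hz hz'
          rw [if_neg hz', if_neg hy.2, hz]
        · by_cases h : y ∈ frontier K
          · simp [h]
          · simp only [if_neg h]
            exact f.2.2 y fun h' => hy ⟨h', h⟩⟩
      map_add' := fun f g => by ext y; by_cases h : y ∈ frontier K <;> simp [h]
      map_smul' := fun c f => by ext y; by_cases h : y ∈ frontier K <;> simp [h] }
  -- Vanishing of the jump is a clopen condition on the boundary, so `hP` spreads it from the test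
  -- points to all of it; then `f` extends across by its inner values.
  have hker : LinearMap.ker L ≤ LinearMap.range R := by
    rintro ⟨f, hf⟩ hLf
    have hfx : ∀ i, f (a (x i)) = f (b (x i)) := fun i => by
      have := congrFun (LinearMap.mem_ker.1 hLf) i
      exact sub_eq_zero.1 this
    have hf' : ∀ y ∈ frontier K ∩ O, f (a y) = f (b y) := by
      refine hP _ (fun y hy => ?_) hfx
      have h1 := (hab y hy f hf).1
      have h2 := (hab y hy f hf).2
      filter_upwards [nhdsWithin_le_nhds (eventually_eventually_nhds.2 h1),
        nhdsWithin_le_nhds (eventually_eventually_nhds.2 h2),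
        nhdsWithin_le_nhds (hO.mem_nhds hy.2), self_mem_nhdsWithin] with z hz1 hz2 hzO hzK
      have hz1' := (hab z ⟨hzK, hzO⟩ f hf).1
      have hz2' := (hab z ⟨hzK, hzO⟩ f hf).2
      have e1 : f (a z) = f (a y) := by
        have hcl : z ∈ closure (interior K) := by
          rw [hK.closure_interior_eq_closure_of_nonempty_interior hi]; exact hzK.1
        obtain ⟨w, hw, hw1, hw2⟩ := (mem_closure_iff_frequently.1 hcl).and_eventually
          (hz1.and hz1') |>.exists
        rw [← hw1 hw, ← hw2 hw]
      have e2 : f (b z) = f (b y) := by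
        have hcl : z ∈ closure (Kᶜ) := by
          rw [frontier_eq_closure_inter_closure] at hzK; exact hzK.2
        obtain ⟨w, hw, hw1, hw2⟩ := (mem_closure_iff_frequently.1 hcl).and_eventually
          (hz2.and hz2') |>.exists
        rw [← hw1 hw, ← hw2 hw]
      rw [e1, e2]
    let g : E → F := fun y => if y ∈ frontier K ∩ O then f (a y) else f y
    have hgn : ∀ y ∈ frontier K ∩ O, ∀ᶠ z in 𝓝 y, z ∉ frontier K → f z = f (a y) := by
      intro y hy
      filter_upwards [(hab y hy f hf).1, (hab y hy f hf).2] with z h1 h2 hz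
      rcases hcases z hz with h | h
      · exact h1 h
      · rw [h2 h, hf' y hy]
    have hg : g ∈ locConstOn F O := by
      refine ⟨fun y hy => ?_, fun y hy => ?_⟩
      · by_cases hyK : y ∈ frontier K
        · have hgy : g y = f (a y) := if_pos ⟨hyK, hy⟩
          filter_upwards [eventually_eventually_nhds.2 (hgn y ⟨hyK, hy⟩),
            hO.mem_nhds hy] with z hz hzO
          rw [hgy]
          by_cases hzK : z ∈ frontier K
          · have hgz : g z = f (a z) := if_pos ⟨hzK, hzO⟩
            rw [hgz]
            have hcl : z ∈ closure (interior K) := by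
              rw [hK.closure_interior_eq_closure_of_nonempty_interior hi]; exact hzK.1
            obtain ⟨w, hw, hw1, hw2⟩ := (mem_closure_iff_frequently.1 hcl).and_eventually
              (hz.and (hgn z ⟨hzK, hzO⟩)) |>.exists
            rw [← hw1 (hint w hw), ← hw2 (hint w hw)]
          · have hgz : g z = f z := if_neg fun h => hzK h.1
            rw [hgz]
            exact hz.self_of_nhds hzK
        · have hgy : g y = f y := if_neg fun h => hyK h.1
          filter_upwards [hf.1 y ⟨hy, hyK⟩, isClosed_frontier.isOpen_compl.mem_nhds hyK]
            with z hz hzK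
          have hgz : g z = f z := if_neg fun h => hzK h.1
          rw [hgy, hgz, hz]
      · have hgy : g y = f y := if_neg fun h => hy h.2
        rw [hgy]
        exact hf.2 y fun h => hy h.1
    refine ⟨⟨g, hg⟩, ?_⟩
    ext y
    change (if y ∈ frontier K then 0 else g y) = f y
    split_ifs with h
    · exact (hf.2 y fun h' => h'.2 h).symm
    · exact if_neg fun h' => h h'.1
  have h1 := LinearMap.rank_range_add_rank_ker L
  have h2 : Module.rank F (LinearMap.ker L) ≤ Module.rank F (locConstOn F O) :=
    (Submodule.rank_mono hker).trans (rank_range_le R)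
  have h3 : Module.rank F (LinearMap.range L) ≤ Fintype.card ι :=
    (Submodule.rank_le _).trans (by rw [rank_fun'])
  rw [← h1, add_comm]
  exact add_le_add h2 h3

/-! ### Entrances of a polygon into convex curves -/

lemma Set.encard_le_two_of_not_lt {S : Set ℝ}
    (h : ∀ a ∈ S, ∀ b ∈ S, ∀ c ∈ S, a < b → b < c → False) : S.encard ≤ 2 := by
  by_contra! hlt
  obtain ⟨t, htS, ht⟩ := Set.exists_subset_encard_eq
    (show (3 : ℕ∞) ≤ S.encard from Order.add_one_le_of_lt hlt)
  obtain ⟨x, y, z, hxy, hxz, hyz, rfl⟩ := Set.encard_eq_three.1 ht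
  have hx : x ∈ S := htS (by simp)
  have hy : y ∈ S := htS (by simp)
  have hz : z ∈ S := htS (by simp)
  rcases lt_or_gt_of_ne hxy with h1 | h1 <;> rcases lt_or_gt_of_ne hxz with h2 | h2 <;>
    rcases lt_or_gt_of_ne hyz with h3 | h3
  · exact h x hx y hy z hz h1 h3
  · exact h x hx z hz y hy h2 h3
  · linarith
  · exact h z hz x hx y hy h2 h1
  · exact h y hy x hx z hz h1 h2
  · linarith
  · exact h y hy z hz x hx h3 h2
  · exact h z hz y hy x hx h3 h1

section

variable {E : Type} [NormedAddCommGroup E] [NormedSpace ℝ E]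

/-- A line leaves the boundary of a convex set and comes back to it at most once. -/
lemma Convex.not_three_mem_frontier {K : Set E} (hK : Convex ℝ K) (hc : IsClosed K)
    (ℓ : ℝ →ᵃ[ℝ] E) {t₁ t₂ t₃ s s' : ℝ} (h₁ : ℓ t₁ ∈ frontier K) (h₂ : ℓ t₂ ∈ frontier K)
    (h₃ : ℓ t₃ ∈ frontier K) (hs : s ∈ Ioo t₁ t₂) (hs' : s' ∈ Ioo t₂ t₃)
    (hsK : ℓ s ∉ frontier K) (hsK' : ℓ s' ∉ frontier K) : False := by
  have hpre : Convex ℝ (ℓ ⁻¹' K) := hK.affine_preimage ℓ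
  have hpre' : Convex ℝ (ℓ ⁻¹' (interior K)) := hK.interior.affine_preimage ℓ
  have hmem : ∀ u ∈ Icc t₁ t₃, ℓ u ∉ frontier K → ℓ u ∈ interior K := by
    intro u hu huK
    have : ℓ u ∈ K := hpre.ordConnected.out (hc.frontier_subset h₁) (hc.frontier_subset h₃) hu
    by_contra h
    exact huK (hc.frontier_eq ▸ ⟨this, h⟩)
  have h4 := hmem s ⟨hs.1.le, by linarith [hs.2, hs'.1, hs'.2]⟩ hsK
  have h5 := hmem s' ⟨by linarith [hs.1, hs.2, hs'.1], hs'.2.le⟩ hsK'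
  -- The two gaps are interior points, so the boundary point between them would be interior too.
  exact h₂.2 (hpre'.ordConnected.out h4 h5 ⟨hs.2.le, hs'.1.le⟩)

/-- The boundary of a polygon is a closed path that is affine between successive integers. -/
lemma Polygon.exists_periodic_parametrization {k : ℕ} (hk : 0 < k) (p : Polygon E k) :
    ∃ γ : ℝ → E, Continuous γ ∧ Function.Periodic γ k ∧ range γ = p.boundary ℝ ∧
      ∀ m : ℤ, ∃ ℓ : ℝ →ᵃ[ℝ] E, ∀ t ∈ Ico (m : ℝ) (m + 1), γ t = ℓ t := by
  have hk' : (0 : ℤ) < k := by exact_mod_cast hk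
  let idx : ℤ → Fin k := fun m => ⟨(m % k).toNat, by
    have := Int.emod_lt_of_pos m hk'
    have := Int.emod_nonneg m hk'.ne'
    omega⟩
  have hidx : ∀ m, idx (m + 1) = finRotate k (idx m) := by
    intro m
    obtain ⟨k, rfl⟩ := Nat.exists_eq_succ_of_ne_zero hk.ne'
    rw [finRotate_apply]
    ext
    rw [Fin.val_add_one]
    have h1 := Int.emod_lt_of_pos m hk'
    have h2 := Int.emod_nonneg m hk'.ne'
    simp only [idx, Fin.ext_iff, Fin.val_last]
    have h3 : (m + 1) % ((k.succ : ℕ) : ℤ) = (m % ((k.succ : ℕ) : ℤ) + 1) % ((k.succ : ℕ) : ℤ) := by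
      simp
    rw [h3]
    generalize m % ((k.succ : ℕ) : ℤ) = r at h1 h2
    split_ifs with h
    · have : r + 1 = ((k.succ : ℕ) : ℤ) := by push_cast; omega
      rw [this]; simp
    · rw [Int.emod_eq_of_lt (by omega) (by push_cast at *; omega)]
      omega
  let ℓ : ℤ → ℝ → E := fun m t => AffineMap.lineMap (p (idx m)) (p (idx (m + 1))) (t - m)
  let γ : ℝ → E := fun t => ℓ ⌊t⌋ t
  have hγIco : ∀ m : ℤ, ∀ t ∈ Ico (m : ℝ) (m + 1), γ t = ℓ m t := by
    intro m t ht
    simp only [γ, Int.floor_eq_iff.2 ht]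
  -- Consecutive edges share a vertex, so the formula also holds at the right end; this gives
  -- continuity.
  have hγIcc : ∀ m : ℤ, ∀ t ∈ Icc (m : ℝ) (m + 1), γ t = ℓ m t := by
    intro m t ht
    rcases ht.2.lt_or_eq with h | h
    · exact hγIco m t ⟨ht.1, h⟩
    · have : γ t = ℓ (m + 1) t := hγIco (m + 1) t ⟨by simp [h], by simp [h]⟩
      rw [this, h]
      simp [ℓ]
  have hℓ : ∀ m, Continuous (ℓ m) := fun m => by
    simp only [ℓ, AffineMap.lineMap_apply]
    fun_prop
  refine ⟨γ, ?_, ?_, ?_, ?_⟩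
  · have hf : LocallyFinite fun m : ℤ => Icc (m : ℝ) (m + 1) := by
      refine locallyFinite_Icc_of_tendsto (f := fun m : ℤ => (m : ℝ))
        (g := fun m : ℤ => (m : ℝ) + 1) tendsto_intCast_atTop_atTop ?_
      exact tendsto_atBot_add_const_right _ _ (tendsto_intCast_atBot_iff.2 tendsto_id)
    refine hf.continuous ?_ (fun m => isClosed_Icc) fun m => ?_
    · exact eq_univ_of_forall fun t =>
        mem_iUnion.2 ⟨⌊t⌋, Int.floor_le t, (Int.lt_floor_add_one t).le⟩
    · exact (hℓ m).continuousOn.congr fun t ht => hγIcc m t ht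
  · intro t
    have h1 : ⌊t + k⌋ = ⌊t⌋ + (k : ℤ) := by
      exact_mod_cast Int.floor_add_intCast t (k : ℤ)
    have h2 : ∀ m : ℤ, idx (m + k) = idx m := fun m => by simp [idx]
    simp only [γ, ℓ, h1]
    rw [h2, add_right_comm, h2]
    congr 1
    push_cast
    ring
  · ext y
    constructor
    · rintro ⟨t, rfl⟩
      refine mem_iUnion.2 ⟨idx ⌊t⌋, t - ⌊t⌋, ⟨?_, ?_⟩, ?_⟩
      · linarith [Int.floor_le t]
      · linarith [Int.lt_floor_add_one t]
      · rw [← hidx]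
    · intro hy
      obtain ⟨i, s, hs, rfl⟩ := mem_iUnion.1 hy
      have hi : idx (i : ℕ) = i := by
        ext
        have : ((i : ℕ) : ℤ) % k = (i : ℕ) := Int.emod_eq_of_lt (by positivity) (by exact_mod_cast i.2)
        simp [idx, this]
      refine ⟨(i : ℕ) + s, ?_⟩
      have := hγIcc (i : ℕ) ((i : ℕ) + s) (by simpa using hs)
      rw [this]
      simp only [ℓ]
      rw [hidx, hi]
      simp
  · intro m
    refine ⟨(AffineMap.lineMap (p (idx m)) (p (idx (m + 1)))).comp
      (AffineMap.id ℝ ℝ - AffineMap.const ℝ ℝ (m : ℝ)), fun t ht => ?_⟩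
    rw [hγIco m t ht]
    simp [ℓ]

/-- Adding a convex polygon to a drawing of convex curves. -/
lemma rank_locConstOn_diff_polygon_le (F : Type) [Field F] {k n : ℕ} (hk : 0 < k)
    (p : Polygon E k) {K : Set E} (hK : Convex ℝ K) (hc : IsClosed K)
    (hi : (interior K).Nonempty) (hpK : p.boundary ℝ = frontier K) (K' : Fin n → Set E)
    (hK' : ∀ i, Convex ℝ (K' i)) (hc' : ∀ i, IsClosed (K' i)) :
    Module.rank F (locConstOn F ((⋃ i, frontier (K' i))ᶜ \ frontier K)) ≤
      Module.rank F (locConstOn F (⋃ i, frontier (K' i))ᶜ) + (max 1 (2 * k * n) : ℕ) := by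
  classical
  have hk' : (0 : ℝ) < k := by exact_mod_cast hk
  obtain ⟨γ, hγ, hper, hran, haff⟩ := p.exists_periodic_parametrization hk
  rw [hpK] at hran
  set O := (⋃ i, frontier (K' i))ᶜ with hOdef
  have hO : IsOpen O := (isClosed_iUnion_of_finite fun i => isClosed_frontier).isOpen_compl
  -- a clopen condition is constant along an interval that stays in `O`
  have hconst : ∀ P : E → Prop,
      (∀ y ∈ frontier K ∩ O, ∀ᶠ z in 𝓝[frontier K] y, (P z ↔ P y)) →
      ∀ I : Set ℝ, IsPreconnected I → (∀ t ∈ I, γ t ∈ O) →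
      ∀ t ∈ I, ∀ t' ∈ I, P (γ t) → P (γ t') := by
    intro P hP I hI hstay t ht t' ht' h
    have hloc : ∀ x ∈ I, ∀ᶠ y in 𝓝[I] x, (P ∘ γ) y = (P ∘ γ) x := by
      intro x hx
      have h1 := hP (γ x) ⟨hran ▸ mem_range_self x, hstay x hx⟩
      have h2 : Tendsto γ (𝓝[I] x) (𝓝[frontier K] (γ x)) :=
        tendsto_nhdsWithin_iff.2 ⟨hγ.continuousWithinAt, Eventually.of_forall fun y =>
          hran ▸ mem_range_self y⟩
      filter_upwards [h2.eventually h1] with y hy using propext hy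
    have := hI.eq_of_eventually_eq hloc ht ht'
    exact (show P (γ t) = P (γ t') from this) ▸ h
  -- If the new curve misses the drawing, it is a single arc and one test point suffices.
  by_cases hall : ∀ t, γ t ∈ O
  · refine (rank_locConstOn_diff_frontier_le (F := F) hK hc hi hO (fun _ : Unit => γ 0) ?_).trans ?_
    · intro P hP h0 y hy
      obtain ⟨t, rfl⟩ : y ∈ range γ := hran ▸ hy.1
      exact hconst P hP univ isPreconnected_univ (fun t _ => hall t) 0 trivial t trivial (h0 ())
    · gcongr
      simp
  push Not at hall
  obtain ⟨t', ht'⟩ := hall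
  -- Entrances: hits of the drawing preceded by a free interval. Overlaps along segments are thus
  -- counted only where they begin.
  let T : Set ℝ := {t | t ∈ Ico (0 : ℝ) k ∧ γ t ∉ O ∧ ∃ ε > 0, ∀ s ∈ Ioo (t - ε) t, γ s ∈ O}
  let T' : Fin n × Fin k → Set ℝ := fun q =>
    {t | t ∈ Ico ((q.2 : ℕ) : ℝ) ((q.2 : ℕ) + 1) ∧ γ t ∈ frontier (K' q.1) ∧
      ∃ ε > 0, ∀ s ∈ Ioo (t - ε) t, γ s ∉ frontier (K' q.1)}
  -- Of three entrances on one edge, the free intervals before the second and the third contradict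
  -- `Convex.not_three_mem_frontier`.
  have hT'2 : ∀ q, (T' q).encard ≤ 2 := by
    intro q
    refine Set.encard_le_two_of_not_lt ?_
    rintro t₁ ⟨h1, h1K, -⟩ t₂ ⟨h2, h2K, ε₂, hε₂, hK₂⟩ t₃ ⟨h3, h3K, ε₃, hε₃, hK₃⟩ h12 h23
    obtain ⟨ℓ, hℓ⟩ := haff (q.2 : ℕ)
    simp only [Int.cast_natCast] at hℓ
    obtain ⟨s, hs, hs'⟩ := exists_between (max_lt h12 (sub_lt_self t₂ hε₂))
    obtain ⟨u, hu, hu'⟩ := exists_between (max_lt h23 (sub_lt_self t₃ hε₃))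
    rw [max_lt_iff] at hs hu
    refine (hK' q.1).not_three_mem_frontier (hc' q.1) ℓ (t₁ := t₁) (t₂ := t₂) (t₃ := t₃)
      (s := s) (s' := u) ?_ ?_ ?_ ⟨hs.1, hs'⟩ ⟨hu.1, hu'⟩ ?_ ?_
    · rwa [← hℓ _ h1]
    · rwa [← hℓ _ h2]
    · rwa [← hℓ _ h3]
    · rw [← hℓ _ ⟨h1.1.trans hs.1.le, hs'.trans h2.2⟩]
      exact hK₂ s ⟨hs.2, hs'⟩
    · rw [← hℓ _ ⟨h2.1.trans hu.1.le, hu'.trans h3.2⟩]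
      exact hK₃ u ⟨hu.2, hu'⟩
  have hTT' : T ⊆ ⋃ q, T' q := by
    rintro t ⟨ht, htO, ε, hε, hs⟩
    obtain ⟨i, hi'⟩ : ∃ i, γ t ∈ frontier (K' i) := by
      simpa [hOdef] using htO
    have hfl : ⌊t⌋₊ < k := (Nat.floor_lt ht.1).2 ht.2
    refine mem_iUnion.2 ⟨(i, ⟨⌊t⌋₊, hfl⟩), ⟨Nat.floor_le ht.1, Nat.lt_floor_add_one t⟩, hi', ε, hε,
      fun s hs' h => ?_⟩
    exact hs s hs' (mem_iUnion.2 ⟨i, h⟩)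
  have hTcard : T.encard ≤ (2 * k * n : ℕ) := by
    refine (encard_le_encard hTT').trans ((Set.encard_iUnion_le_of_fintype T').trans ?_)
    refine (Finset.sum_le_sum fun q _ => hT'2 q).trans (le_of_eq ?_)
    simp
    ring
  have hTfin : T.Finite := Set.finite_of_encard_le_coe hTcard
  have : Fintype T := hTfin.fintype
  have hs : ∀ t : T, ∃ s, s < t.1 ∧ ∀ u ∈ Ico s t.1, γ u ∈ O := by
    rintro ⟨t, ht, htO, ε, hε, hs⟩
    exact ⟨t - ε / 2, by simpa using hε, fun u hu => hs u ⟨by linarith [hu.1], hu.2⟩⟩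
  choose s hs hsO using hs
  refine (rank_locConstOn_diff_frontier_le (F := F) hK hc hi hO (fun t : T => γ (s t)) ?_).trans ?_
  · intro P hP hPT y hy
    obtain ⟨t₀, rfl⟩ : y ∈ range γ := hran ▸ hy.1
    -- Run forward from `t₀` to the first hit. Modulo `k` it is an entrance, and its test point is
    -- joined to `γ t₀` inside `O`.
    let A : Set ℝ := {t | t₀ ≤ t ∧ γ t ∉ O}
    have hAc : IsClosed A :=
      isClosed_Ici.inter (hO.isClosed_compl.preimage hγ)
    have hAn : A.Nonempty := by
      obtain ⟨N, hN⟩ := exists_nat_ge ((t₀ - t') / k)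
      refine ⟨t' + N * k, ?_, ?_⟩
      · have := (div_le_iff₀ hk').1 hN
        linarith
      · rwa [hper.nat_mul N t']
    have hAb : BddBelow A := ⟨t₀, fun t ht => ht.1⟩
    have h1 : sInf A ∈ A := hAc.csInf_mem hAn hAb
    set t₁ := sInf A with ht₁
    have ht₀₁ : t₀ < t₁ := h1.1.lt_of_ne fun h => h1.2 (h ▸ hy.2)
    have hO₁ : ∀ t ∈ Ico t₀ t₁, γ t ∈ O := by
      intro t ht
      by_contra h
      exact (csInf_le hAb ⟨ht.1, h⟩).not_gt ht.2
    let q := toIcoDiv hk' 0 t₁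
    have hq : t₁ - q * k ∈ T := by
      have h2 := sub_toIcoDiv_zsmul_mem_Ico hk' 0 t₁
      rw [zsmul_eq_mul, zero_add] at h2
      refine ⟨h2, ?_, t₁ - t₀, by linarith, fun u hu => ?_⟩
      · rw [hper.sub_int_mul_eq q]; exact h1.2
      · rw [← hper.int_mul q u]
        exact hO₁ _ ⟨by linarith [hu.1], by linarith [hu.2]⟩
    have h3 := hPT ⟨_, hq⟩
    have h4 := hs ⟨_, hq⟩
    have h5 := hsO ⟨_, hq⟩
    set σ := s ⟨_, hq⟩
    simp only at h4 h5
    have h6 : ∀ u ∈ Ico (σ + q * k) t₁, γ u ∈ O := by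
      intro u hu
      rw [← hper.sub_int_mul_eq q]
      exact h5 _ ⟨by linarith [hu.1], by linarith [hu.2]⟩
    rw [← hper.int_mul q σ] at h3
    have h7 : max t₀ (σ + q * k) < t₁ := max_lt ht₀₁ (by linarith)
    have h8 := hconst P hP _ isPreconnected_Ico h6 (σ + q * k) ⟨le_rfl, by linarith⟩
      _ ⟨le_max_right t₀ _, h7⟩ h3
    exact hconst P hP _ isPreconnected_Ico hO₁ _ ⟨le_max_left _ _, h7⟩ t₀ ⟨le_rfl, ht₀₁⟩ h8
  · gcongr
    refine le_trans ?_ (le_max_right _ _)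
    rw [← Nat.cast_le (α := ℕ∞)]
    refine le_trans (le_of_eq ?_) hTcard
    rw [Set.encard, ENat.card_eq_coe_fintype_card]

end

/-! ### The upper bound -/

/-- Three vertices cannot be collinear, since the middle one would lie in the hull of the other two;
hence they span the plane. -/
lemma ConvexIndependent.interior_convexHull_nonempty {k : ℕ} (hk : 3 ≤ k) {v : Fin k → Plane}
    (hv : ConvexIndependent ℝ v) : (interior (convexHull ℝ (range v))).Nonempty := by
  rw [interior_convexHull_nonempty_iff_affineSpan_eq_top]
  let i : Fin k := ⟨0, by omega⟩
  let j : Fin k := ⟨1, by omega⟩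
  let l : Fin k := ⟨2, by omega⟩
  have hno : ∀ a b c : Fin k, a ≠ b → b ≠ c → ¬ Wbtw ℝ (v a) (v b) (v c) := by
    intro a b c hab hbc h
    have h1 : v b ∈ convexHull ℝ (v '' {a, c}) := by
      rw [image_pair, convexHull_pair, ← affineSegment_eq_segment]
      exact h
    rcases hv {a, c} b h1 with h2 | h2
    · exact hab h2.symm
    · exact hbc h2
  have hij : i ≠ j := by simp [i, j]
  have hjl : j ≠ l := by simp [j, l]
  have hil : i ≠ l := by simp [i, l]
  have hnc : ¬ Collinear ℝ {v i, v j, v l} := by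
    intro h
    rcases h.wbtw_or_wbtw_or_wbtw with h | h | h
    · exact hno _ _ _ hij hjl h
    · exact hno _ _ _ hjl hil.symm h
    · exact hno _ _ _ hil.symm hij h
  have hai := affineIndependent_iff_not_collinear_set.2 hnc
  have htop := hai.affineSpan_eq_top_iff_card_eq_finrank_add_one.2 (by simp)
  refine top_le_iff.1 (htop ▸ affineSpan_mono ℝ ?_)
  rintro _ ⟨t, rfl⟩
  fin_cases t <;> simp

lemma rank_locConstOn_univ_le (F : Type) [Field F] {X : Type} [TopologicalSpace X]
    [ConnectedSpace X] : Module.rank F (locConstOn F (univ : Set X)) ≤ 1 := by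
  obtain ⟨x⟩ := (inferInstance : Nonempty X)
  let L : locConstOn F (univ : Set X) →ₗ[F] F := (LinearMap.proj x).comp (Submodule.subtype _)
  have hL : Function.Injective L := by
    intro f g h
    ext y
    have hf := locConstOn_eq_of_isPreconnected f.2 isPreconnected_univ subset_rfl
      (mem_univ y) (mem_univ x)
    have hg := locConstOn_eq_of_isPreconnected g.2 isPreconnected_univ subset_rfl
      (mem_univ y) (mem_univ x)
    rw [hf, hg]
    exact h
  simpa using L.rank_le_of_injective hL

lemma rank_locConstOn_compl_polygons_le (F : Type) [Field F] {k : ℕ} (hk : 3 ≤ k) (n : ℕ)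
    (c : Fin n → Set Plane) (hc : ∀ i, c i ∈ convexPolygonCurves k) :
    Module.rank F (locConstOn F (⋃ i, c i)ᶜ) ≤
      ((if n = 0 then 1 else k * n ^ 2 - k * n + 2 : ℕ) : Cardinal) := by
  induction n with
  | zero =>
    have hU : (⋃ i, c i)ᶜ = univ := by rw [iUnion_of_empty, compl_empty]
    rw [hU]
    simpa using rank_locConstOn_univ_le F (X := Plane)
  | succ n ih =>
    have ih' := ih (fun i => c i.castSucc) fun i => hc _
    choose p hp hcp using hc
    have hset : (⋃ i, c i)ᶜ = (⋃ i : Fin n, c i.castSucc)ᶜ \ c (Fin.last n) := by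
      ext x
      simp [Fin.forall_fin_succ']
    have hfr : ∀ i, c i = frontier (convexHull ℝ (range (p i).vertices)) := fun i =>
      (hcp i).trans (hp i).2
    have hclosed : ∀ i, IsClosed (convexHull ℝ (range (p i).vertices)) := fun i =>
      (finite_range _).isClosed_convexHull ℝ
    have hstep := rank_locConstOn_diff_polygon_le F (by omega : 0 < k) (p (Fin.last n))
      (convex_convexHull ℝ _) (hclosed _) ((hp _).1.interior_convexHull_nonempty hk) (hp _).2
      (fun i : Fin n => convexHull ℝ (range (p i.castSucc).vertices))
      (fun i => convex_convexHull ℝ _) (fun i => hclosed _)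
    have hU : (⋃ i : Fin n, frontier (convexHull ℝ (range (p i.castSucc).vertices))) =
        ⋃ i : Fin n, c i.castSucc := iUnion_congr fun i => (hfr _).symm
    rw [hU, ← hfr (Fin.last n)] at hstep
    rw [hset]
    refine hstep.trans ((add_le_add_left ih' _).trans ?_)
    rw [← Nat.cast_add, Nat.cast_le]
    rcases Nat.eq_zero_or_pos n with rfl | hn
    · simp
    -- The increment is $2kn = k(n+1)n - kn(n-1)$; `h1` makes the truncated subtraction genuine.
    · rw [if_neg hn.ne', if_neg (by omega), max_eq_right (by nlinarith)]
      have h1 : k * n ≤ k * n ^ 2 := Nat.mul_le_mul_left _ (Nat.le_self_pow two_ne_zero n)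
      have h2 : k * (n + 1) ^ 2 = k * n ^ 2 + 2 * k * n + k := by ring
      have h3 : k * (n + 1) = k * n + k := by ring
      omega

lemma numRegions_le_of_convexPolygonCurves {k : ℕ} (hk : 3 ≤ k) (n : ℕ)
    (c : Fin n → Set Plane) (hc : ∀ i, c i ∈ convexPolygonCurves k) :
    numRegions (⋃ i, c i) ≤ ((if n = 0 then 1 else k * n ^ 2 - k * n + 2 : ℕ) : ℕ∞) := by
  refine card_connectedComponents_le_rank_locConstOn ℚ ?_
    (rank_locConstOn_compl_polygons_le ℚ hk n c hc)
  refine (isClosed_iUnion_of_finite fun i => ?_).isOpen_compl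
  obtain ⟨p, hp, h⟩ := hc i
  rw [h, hp.2]
  exact isClosed_frontier

lemma regionNumbers_zero (S : Set (Set Plane)) : regionNumbers S 0 = {1} := by
  have h1 : numRegions ∅ = 1 := by
    rw [numRegions, compl_empty]
    have : Subsingleton (ConnectedComponents (univ : Set Plane)) :=
      have : PreconnectedSpace (univ : Set Plane) := Subtype.preconnectedSpace isPreconnected_univ
      inferInstance
    have : Nonempty (ConnectedComponents (univ : Set Plane)) := ⟨ConnectedComponents.mk ⟨0, trivial⟩⟩
    exact le_antisymm (ENat.card_le_one_iff_subsingleton _ |>.2 ‹_›)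
      (ENat.one_le_card_iff_nonempty _ |>.2 ‹_›)
  ext r
  simp [regionNumbers, h1]

/-! ### Regular polygons as intersections of half-planes -/

/-- The point of the unit circle with argument `θ`. -/
noncomputable def circlePoint (θ : ℝ) : Plane := !₂[Real.cos θ, Real.sin θ]

/-- The height of a point of the plane in the direction with argument `θ`. -/
noncomputable def heightAlong (θ : ℝ) (z : Plane) : ℝ := z 0 * Real.cos θ + z 1 * Real.sin θ

lemma isLinearMap_heightAlong (θ : ℝ) : IsLinearMap ℝ (heightAlong θ) where
  map_add x y := by simp [heightAlong]; ring
  map_smul c x := by simp [heightAlong]; ring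

lemma continuous_heightAlong (θ : ℝ) : Continuous (heightAlong θ) := by
  unfold heightAlong
  fun_prop

lemma heightAlong_circlePoint (θ φ : ℝ) : heightAlong θ (circlePoint φ) = Real.cos (φ - θ) := by
  simp [heightAlong, circlePoint, Real.cos_sub]

lemma heightAlong_combination (θ a b : ℝ) (x y : Plane) :
    heightAlong θ (a • x + b • y) = a * heightAlong θ x + b * heightAlong θ y := by
  rw [(isLinearMap_heightAlong θ).map_add, (isLinearMap_heightAlong θ).map_smul,
    (isLinearMap_heightAlong θ).map_smul, smul_eq_mul, smul_eq_mul]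

lemma heightAlong_add_two_pi_mul (θ : ℝ) (m : ℤ) (z : Plane) :
    heightAlong (θ + m * (2 * Real.pi)) z = heightAlong θ z := by
  simp [heightAlong, Real.cos_add_int_mul_two_pi, Real.sin_add_int_mul_two_pi]

lemma circlePoint_add_two_pi_mul (θ : ℝ) (m : ℤ) :
    circlePoint (θ + m * (2 * Real.pi)) = circlePoint θ := by
  simp [circlePoint, Real.cos_add_int_mul_two_pi, Real.sin_add_int_mul_two_pi]

lemma exists_eq_smul_circlePoint (z : Plane) : ∃ ρ φ : ℝ, 0 ≤ ρ ∧ z = ρ • circlePoint φ := by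
  refine ⟨‖(⟨z 0, z 1⟩ : ℂ)‖, Complex.arg ⟨z 0, z 1⟩, norm_nonneg _, ?_⟩
  ext i
  fin_cases i
  · simp [circlePoint, Complex.norm_mul_cos_arg]
  · simp [circlePoint, Complex.norm_mul_sin_arg]

lemma Real.cos_le_cos_of_mem_Icc {a x : ℝ} (ha : 0 ≤ a) (hx : x ∈ Icc a (2 * Real.pi - a)) :
    Real.cos x ≤ Real.cos a := by
  rcases le_total x Real.pi with h | h
  · exact Real.cos_le_cos_of_nonneg_of_le_pi ha h hx.1
  · rw [← Real.cos_two_pi_sub x]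
    exact Real.cos_le_cos_of_nonneg_of_le_pi ha (by linarith) (by linarith [hx.2])

/-- The regular `k`-gon inscribed in the unit circle, turned by the angle `α`. -/
noncomputable def rotatedPolygon (k : ℕ) (α : ℝ) : Polygon Plane k where
  vertices j := circlePoint (α + 2 * Real.pi * (j : ℕ) / k)

/-- The argument of the normal to the `j`-th edge of the turned regular `k`-gon. -/
noncomputable def edgeNormal (k : ℕ) (α : ℝ) (j : ℤ) : ℝ :=
  α + Real.pi / k + 2 * Real.pi * j / k

section

variable {k : ℕ}

lemma circlePoint_mem_range_rotatedPolygon (hk : 0 < k) (α : ℝ) (j : ℤ) :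
    circlePoint (α + 2 * Real.pi * j / k) ∈ range (rotatedPolygon k α).vertices := by
  have hk' : (0 : ℤ) < k := by exact_mod_cast hk
  have h1 := Int.emod_lt_of_pos j hk'
  have h2 := Int.emod_nonneg j hk'.ne'
  refine ⟨⟨(j % k).toNat, by omega⟩, ?_⟩
  simp only [rotatedPolygon]
  have h3 : (((j % k).toNat : ℕ) : ℝ) = j - k * (j / k : ℤ) := by
    have : (((j % k).toNat : ℕ) : ℤ) = j - k * (j / k) := by
      rw [Int.toNat_of_nonneg h2, Int.emod_def]
    exact_mod_cast this
  rw [h3, ← circlePoint_add_two_pi_mul _ (j / k)]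
  congr 1
  have : (k : ℝ) ≠ 0 := by positivity
  field_simp
  ring

lemma rotatedPolygon_finRotate (hk : 0 < k) (α : ℝ) (i : Fin k) :
    rotatedPolygon k α (finRotate k i) =
      circlePoint (α + 2 * Real.pi * ((i : ℕ) + 1 : ℤ) / k) := by
  obtain ⟨k, rfl⟩ := Nat.exists_eq_succ_of_ne_zero hk.ne'
  rw [finRotate_apply]
  simp only [rotatedPolygon]
  rw [Fin.val_add_one]
  split_ifs with h
  · rw [← circlePoint_add_two_pi_mul _ 1]
    congr 1
    have : ((k.succ : ℕ) : ℝ) ≠ 0 := by positivity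
    subst h
    simp only [Fin.val_last]
    push_cast at *
    field_simp
    ring
  · push_cast
    rfl

/-- Every point of the plane is in one of the sectors spanned by the edges of a turned regular
polygon. -/
lemma exists_mem_sector (hk : 3 ≤ k) (α : ℝ) (z : Plane) : ∃ (j : ℤ) (a b : ℝ), 0 ≤ a ∧ 0 ≤ b ∧
    z = a • circlePoint (α + 2 * Real.pi * j / k) +
      b • circlePoint (α + 2 * Real.pi * (j + 1 : ℤ) / k) := by
  obtain ⟨ρ, φ, hρ, rfl⟩ := exists_eq_smul_circlePoint z
  have hk' : (3 : ℝ) ≤ k := by exact_mod_cast hk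
  have hk0 : (0 : ℝ) < k := by linarith
  have hπ := Real.pi_pos
  set w := 2 * Real.pi / k with hw
  have hw0 : 0 < w := by positivity
  have hwπ : w < Real.pi := by rw [hw, div_lt_iff₀ hk0]; nlinarith
  set j := ⌊(φ - α) / w⌋ with hj
  have h1 : j * w ≤ φ - α := (le_div_iff₀ hw0).1 (Int.floor_le _)
  have h2 : φ - α < (j + 1) * w := (div_lt_iff₀ hw0).1 (Int.lt_floor_add_one _)
  set τ := φ - α - j * w with hτ
  have hs : 0 < Real.sin w := Real.sin_pos_of_pos_of_lt_pi hw0 hwπ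
  have hs1 : 0 ≤ Real.sin τ := Real.sin_nonneg_of_nonneg_of_le_pi (by linarith) (by linarith)
  have hs2 : 0 ≤ Real.sin (w - τ) :=
    Real.sin_nonneg_of_nonneg_of_le_pi (by linarith) (by linarith)
  refine ⟨j, ρ * Real.sin (w - τ) / Real.sin w, ρ * Real.sin τ / Real.sin w, by positivity,
    by positivity, ?_⟩
  have e1 : α + 2 * Real.pi * j / k = φ - τ := by rw [hτ, hw]; ring
  have e2 : α + 2 * Real.pi * (j + 1 : ℤ) / k = φ - τ + w := by rw [hτ, hw]; push_cast; ring
  rw [e1, e2]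
  -- The sine rule for splitting a direction along two others at angle `w`; here $k\ge3$ gives
  -- $w<\pi$ and $\sin w>0$.
  have key : ∀ x, ρ • circlePoint (x + τ) = (ρ * Real.sin (w - τ) / Real.sin w) • circlePoint x +
      (ρ * Real.sin τ / Real.sin w) • circlePoint (x + w) := by
    intro x
    ext i
    fin_cases i
    · simp [circlePoint, Real.cos_add, Real.sin_sub]
      field_simp
      ring
    · simp [circlePoint, Real.sin_add, Real.sin_sub]
      field_simp
      ring
  simpa using key (φ - τ)

lemma cos_pi_div_pos (hk : 3 ≤ k) : 0 < Real.cos (Real.pi / k) := by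
  have hk' : (3 : ℝ) ≤ k := by exact_mod_cast hk
  have hπ := Real.pi_pos
  refine Real.cos_pos_of_mem_Ioo ⟨?_, ?_⟩
  · have : 0 < Real.pi / k := by positivity
    linarith
  · exact div_lt_div_of_pos_left hπ (by norm_num) (by linarith)

/-- A vertex and an edge normal differ by an odd multiple of $\pi/k$, so their angle is at least
$\pi/k$ modulo a full turn. -/
lemma heightAlong_edgeNormal_circlePoint_le (hk : 0 < k) (α : ℝ) (i j : ℤ) :
    heightAlong (edgeNormal k α j) (circlePoint (α + 2 * Real.pi * i / k)) ≤
      Real.cos (Real.pi / k) := by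
  have hk' : (0 : ℤ) < k := by exact_mod_cast hk
  have hk0 : (0 : ℝ) < k := by exact_mod_cast hk
  have hπ := Real.pi_pos
  rw [heightAlong_circlePoint]
  have h1 := Int.emod_lt_of_pos (i - j - 1) hk'
  have h2 := Int.emod_nonneg (i - j - 1) hk'.ne'
  have h3 := Int.emod_def (i - j - 1) k
  set r := (i - j - 1) % (k : ℤ)
  set q := (i - j - 1) / (k : ℤ)
  have h4 : (i : ℝ) = j + 1 + r + k * q := by
    have : i = j + 1 + r + k * q := by linarith
    exact_mod_cast this
  have e : α + 2 * Real.pi * i / k - edgeNormal k α j =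
      (2 * r + 1) * (Real.pi / k) + q * (2 * Real.pi) := by
    rw [edgeNormal, h4]
    field_simp
    ring
  rw [e, Real.cos_add_int_mul_two_pi]
  have h5 : (0 : ℝ) ≤ r := by exact_mod_cast h2
  have h6 : (r : ℝ) ≤ k - 1 := by
    have : r ≤ k - 1 := by omega
    exact_mod_cast this
  have hw : 0 < Real.pi / k := by positivity
  refine Real.cos_le_cos_of_mem_Icc hw.le ⟨by nlinarith, ?_⟩
  have : Real.pi = k * (Real.pi / k) := by field_simp
  nlinarith

lemma heightAlong_edgeNormal_start (α : ℝ) (j : ℤ) :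
    heightAlong (edgeNormal k α j) (circlePoint (α + 2 * Real.pi * j / k)) =
      Real.cos (Real.pi / k) := by
  rw [heightAlong_circlePoint, edgeNormal, ← Real.cos_neg]
  congr 1
  ring

lemma heightAlong_edgeNormal_end (α : ℝ) (j : ℤ) :
    heightAlong (edgeNormal k α j) (circlePoint (α + 2 * Real.pi * (j + 1 : ℤ) / k)) =
      Real.cos (Real.pi / k) := by
  rw [heightAlong_circlePoint, edgeNormal]
  congr 1
  push_cast
  ring

/-- In the sector of edge `j`, a point with coordinates `a`, `b` has height $(a+b)\cos(\pi/k)$ along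
the normal. The inequality for that one `j` puts it in the triangle of the centre and the edge. -/
lemma mem_convexHull_rotatedPolygon_iff (hk : 3 ≤ k) (α : ℝ) (z : Plane) :
    z ∈ convexHull ℝ (range (rotatedPolygon k α).vertices) ↔
      ∀ j, heightAlong (edgeNormal k α j) z ≤ Real.cos (Real.pi / k) := by
  have hk0 : 0 < k := by omega
  have hv : ∀ j : ℤ, circlePoint (α + 2 * Real.pi * j / k) ∈
      convexHull ℝ (range (rotatedPolygon k α).vertices) := fun j =>
    subset_convexHull ℝ _ (circlePoint_mem_range_rotatedPolygon hk0 α j)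
  have hconv := convex_convexHull ℝ (range (rotatedPolygon k α).vertices)
  constructor
  · intro hz j
    refine convexHull_min ?_ (convex_halfSpace_le (isLinearMap_heightAlong _) _) hz
    rintro _ ⟨i, rfl⟩
    exact heightAlong_edgeNormal_circlePoint_le hk0 α (i : ℕ) j
  · intro hz
    -- The opposite of a vertex lies in some sector, so the centre is a convex combination of that
    -- vertex and the two ends of an edge.
    have h0 : (0 : Plane) ∈ convexHull ℝ (range (rotatedPolygon k α).vertices) := by
      obtain ⟨j, a, b, ha, hb, h⟩ :=
        exists_mem_sector hk α (-circlePoint (α + 2 * Real.pi * (0 : ℤ) / k))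
      have hs : 0 < 1 + a + b := by positivity
      have := hconv.sum_mem (t := Finset.univ) (w := ![1 / (1 + a + b), a / (1 + a + b),
          b / (1 + a + b)]) (z := ![circlePoint (α + 2 * Real.pi * (0 : ℤ) / k),
            circlePoint (α + 2 * Real.pi * j / k),
            circlePoint (α + 2 * Real.pi * (j + 1 : ℤ) / k)]) ?_ ?_ ?_
      · convert this using 1
        simp only [Fin.sum_univ_three, Matrix.cons_val_zero, Matrix.cons_val_one, Matrix.cons_val]
        have h' : a • circlePoint (α + 2 * Real.pi * j / k) +
            b • circlePoint (α + 2 * Real.pi * (j + 1 : ℤ) / k) +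
            circlePoint (α + 2 * Real.pi * (0 : ℤ) / k) = 0 := by rw [← h]; simp
        rw [← smul_zero (1 / (1 + a + b)), ← h']
        module
      · intro i _
        fin_cases i <;> simp <;> positivity
      · simp [Fin.sum_univ_three]
        field_simp
      · intro i _
        fin_cases i
        exacts [hv _, hv _, hv _]
    obtain ⟨j, a, b, ha, hb, h⟩ := exists_mem_sector hk α z
    have h1 := hz j
    rw [h, heightAlong_combination, heightAlong_edgeNormal_start, heightAlong_edgeNormal_end] at h1
    have hc := cos_pi_div_pos hk
    have hab : a + b ≤ 1 := by nlinarith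
    have := hconv.sum_mem (t := Finset.univ) (w := ![1 - a - b, a, b])
      (z := ![0, circlePoint (α + 2 * Real.pi * j / k),
            circlePoint (α + 2 * Real.pi * (j + 1 : ℤ) / k)]) ?_ ?_ ?_
    · convert this using 1
      simp only [Fin.sum_univ_three, Matrix.cons_val_zero, Matrix.cons_val_one, Matrix.cons_val]
      rw [h, smul_zero, zero_add]
    · intro i _
      fin_cases i <;> simp <;> linarith
    · simp [Fin.sum_univ_three]
      ring
    · intro i _
      fin_cases i
      exacts [h0, hv _, hv _]

lemma edgeNormal_emod (hk : 0 < k) (α : ℝ) (j : ℤ) (z : Plane) :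
    heightAlong (edgeNormal k α (j % k)) z = heightAlong (edgeNormal k α j) z := by
  rw [← heightAlong_add_two_pi_mul (edgeNormal k α (j % k)) (j / k)]
  congr 1
  have : (k : ℝ) ≠ 0 := by positivity
  rw [Int.emod_def, edgeNormal, edgeNormal]
  push_cast
  field_simp
  ring

lemma isOpen_setOf_forall_heightAlong_lt (hk : 0 < k) (α c : ℝ) :
    IsOpen {z : Plane | ∀ j, heightAlong (edgeNormal k α j) z < c} := by
  have hk' : (0 : ℤ) < k := by exact_mod_cast hk
  have : {z : Plane | ∀ j, heightAlong (edgeNormal k α j) z < c} =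
      ⋂ i ∈ Finset.Ico (0 : ℤ) k, {z | heightAlong (edgeNormal k α i) z < c} := by
    ext z
    simp only [mem_ofPred_eq, mem_iInter, Finset.mem_Ico]
    refine ⟨fun h i _ => h i, fun h j => ?_⟩
    rw [← edgeNormal_emod hk]
    exact h _ ⟨Int.emod_nonneg j hk'.ne', Int.emod_lt_of_pos j hk'⟩
  rw [this]
  exact isOpen_biInter_finset fun i _ => isOpen_lt (continuous_heightAlong _) continuous_const

lemma mem_frontier_convexHull_rotatedPolygon_iff (hk : 3 ≤ k) (α : ℝ) (z : Plane) :
    z ∈ frontier (convexHull ℝ (range (rotatedPolygon k α).vertices)) ↔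
      (∀ j, heightAlong (edgeNormal k α j) z ≤ Real.cos (Real.pi / k)) ∧
        ∃ j, heightAlong (edgeNormal k α j) z = Real.cos (Real.pi / k) := by
  have hclosed : IsClosed (convexHull ℝ (range (rotatedPolygon k α).vertices)) :=
    (finite_range _).isClosed_convexHull ℝ
  rw [hclosed.frontier_eq, Set.mem_sdiff, mem_convexHull_rotatedPolygon_iff hk]
  refine and_congr_right fun hz => ?_
  constructor
  · intro h
    by_contra! h'
    refine h (mem_interior.2 ⟨_, ?_, isOpen_setOf_forall_heightAlong_lt (by omega) α _,
      fun j => (hz j).lt_of_ne (h' j)⟩)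
    exact fun w hw => (mem_convexHull_rotatedPolygon_iff hk α w).2 fun j => (hw j).le
  · rintro ⟨j, hj⟩ h
    have hcont : Continuous fun s : ℝ => (1 : ℝ) • z + s • circlePoint (edgeNormal k α j) := by
      fun_prop
    have h1 : ∀ᶠ s : ℝ in 𝓝 0, (1 : ℝ) • z + s • circlePoint (edgeNormal k α j) ∈
        interior (convexHull ℝ (range (rotatedPolygon k α).vertices)) :=
      hcont.continuousAt.eventually_mem (isOpen_interior.mem_nhds (by simpa using h))
    obtain ⟨s, hs, hs0⟩ := ((h1.filter_mono nhdsWithin_le_nhds).and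
      (self_mem_nhdsWithin (s := Ioi (0 : ℝ)))).exists
    have h2 := (mem_convexHull_rotatedPolygon_iff hk α _).1 (interior_subset hs) j
    rw [heightAlong_combination, heightAlong_circlePoint, hj, sub_self, Real.cos_zero] at h2
    have : 0 < s := hs0
    linarith

lemma rotatedPolygon_boundary (hk : 3 ≤ k) (α : ℝ) : (rotatedPolygon k α).boundary ℝ =
    frontier (convexHull ℝ (range (rotatedPolygon k α).vertices)) := by
  have hk0 : 0 < k := by omega
  have hk' : (0 : ℤ) < k := by exact_mod_cast hk0
  have hc := cos_pi_div_pos hk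
  ext z
  rw [mem_frontier_convexHull_rotatedPolygon_iff hk]
  constructor
  · intro hz
    obtain ⟨i, hi⟩ := mem_iUnion.1 hz
    rw [Polygon.edgeSet, affineSegment_eq_segment, rotatedPolygon_finRotate hk0] at hi
    obtain ⟨a, b, ha, hb, hab, rfl⟩ := hi
    change (∀ j, heightAlong (edgeNormal k α j)
      (a • circlePoint (α + 2 * Real.pi * ((i : ℕ) : ℤ) / k) + _) ≤ _) ∧ ∃ j,
      heightAlong (edgeNormal k α j)
      (a • circlePoint (α + 2 * Real.pi * ((i : ℕ) : ℤ) / k) + _) = _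
    refine ⟨fun j => ?_, (i : ℕ), ?_⟩
    · rw [heightAlong_combination]
      have h1 := heightAlong_edgeNormal_circlePoint_le hk0 α (i : ℕ) j
      have h2 := heightAlong_edgeNormal_circlePoint_le hk0 α ((i : ℕ) + 1) j
      have := add_le_add (mul_le_mul_of_nonneg_left h1 ha) (mul_le_mul_of_nonneg_left h2 hb)
      rwa [← add_mul, hab, one_mul] at this
    · rw [heightAlong_combination, heightAlong_edgeNormal_start, heightAlong_edgeNormal_end,
        ← add_mul, hab, one_mul]
  · rintro ⟨hz, i, hi⟩
    obtain ⟨j, a, b, ha, hb, rfl⟩ := exists_mem_sector hk α z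
    have h1 := hz j
    rw [heightAlong_combination, heightAlong_edgeNormal_start, heightAlong_edgeNormal_end] at h1
    have h2 := heightAlong_edgeNormal_circlePoint_le hk0 α j i
    have h3 := heightAlong_edgeNormal_circlePoint_le hk0 α (j + 1) i
    rw [heightAlong_combination] at hi
    -- The sector inequality gives $a+b\le1$; attaining the height of edge `i`, which no vertex
    -- exceeds, gives $a+b\ge1$.
    have hab : a + b = 1 := by
      have := add_le_add (mul_le_mul_of_nonneg_left h2 ha) (mul_le_mul_of_nonneg_left h3 hb)
      nlinarith
    have h4 := Int.emod_lt_of_pos j hk'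
    have h5 := Int.emod_nonneg j hk'.ne'
    refine mem_iUnion.2 ⟨⟨(j % k).toNat, by omega⟩, ?_⟩
    rw [Polygon.edgeSet, affineSegment_eq_segment, rotatedPolygon_finRotate hk0]
    refine ⟨a, b, ha, hb, hab, ?_⟩
    have h6 : ∀ x : ℤ, circlePoint (α + 2 * Real.pi * (((j % k).toNat : ℤ) + x : ℤ) / k) =
        circlePoint (α + 2 * Real.pi * (j + x : ℤ) / k) := by
      intro x
      rw [Int.toNat_of_nonneg h5, Int.emod_def, ← circlePoint_add_two_pi_mul _ (j / k)]
      congr 1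
      have : (k : ℝ) ≠ 0 := by positivity
      push_cast
      field_simp
      ring
    have h7 := h6 0
    simp only [add_zero] at h7
    exact congrArg₂ (fun x y => a • x + b • y) h7 (h6 1)

lemma mem_rotatedPolygon_boundary_iff (hk : 3 ≤ k) (α : ℝ) (z : Plane) :
    z ∈ (rotatedPolygon k α).boundary ℝ ↔
      (∀ j, heightAlong (edgeNormal k α j) z ≤ Real.cos (Real.pi / k)) ∧
        ∃ j, heightAlong (edgeNormal k α j) z = Real.cos (Real.pi / k) := by
  rw [rotatedPolygon_boundary hk, mem_frontier_convexHull_rotatedPolygon_iff hk]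

/-- Each vertex is the only one of height 1 in its own direction, so an open half-plane contains all
the others. -/
lemma rotatedPolygon_convexIndependent (hk : 0 < k) (α : ℝ) :
    ConvexIndependent ℝ (rotatedPolygon k α).vertices := by
  have hk0 : (0 : ℝ) < k := by exact_mod_cast hk
  have hπ := Real.pi_pos
  intro s i hi
  by_contra his
  have hsub : convexHull ℝ ((rotatedPolygon k α).vertices '' s) ⊆
      {z | heightAlong (α + 2 * Real.pi * (i : ℕ) / k) z < 1} := by
    refine convexHull_min ?_ (convex_halfSpace_lt (isLinearMap_heightAlong _) _)
    rintro _ ⟨j, hj, rfl⟩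
    have hij : (j : ℕ) ≠ i := fun h => his (Fin.ext h ▸ hj)
    simp only [rotatedPolygon, mem_ofPred_eq, heightAlong_circlePoint]
    refine (Real.cos_le_one _).lt_of_ne fun h => ?_
    have e : α + 2 * Real.pi * (j : ℕ) / k - (α + 2 * Real.pi * (i : ℕ) / k) =
        2 * Real.pi * (((j : ℕ) - (i : ℕ)) / k) := by ring
    have hj1 : ((j : ℕ) : ℝ) < k := by exact_mod_cast j.2
    have hi1 : ((i : ℕ) : ℝ) < k := by exact_mod_cast i.2
    have hj0 : (0 : ℝ) ≤ (j : ℕ) := by positivity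
    have hi0 : (0 : ℝ) ≤ (i : ℕ) := by positivity
    have h1 : -1 < (((j : ℕ) : ℝ) - (i : ℕ)) / k := by rw [lt_div_iff₀ hk0]; linarith
    have h2 : (((j : ℕ) : ℝ) - (i : ℕ)) / k < 1 := by rw [div_lt_iff₀ hk0]; linarith
    rw [e, Real.cos_eq_one_iff_of_lt_of_lt (by nlinarith) (by nlinarith)] at h
    have h3 : (((j : ℕ) : ℝ) - (i : ℕ)) = 0 := by
      rcases mul_eq_zero.1 h with h | h
      · linarith
      · exact (div_eq_zero_iff.1 h).resolve_right hk0.ne'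
    exact hij (by exact_mod_cast sub_eq_zero.1 h3)
  have := hsub hi
  simp [rotatedPolygon, heightAlong_circlePoint] at this

lemma isConvexPolygon_rotatedPolygon (hk : 3 ≤ k) (α : ℝ) :
    IsConvexPolygon (rotatedPolygon k α) :=
  ⟨rotatedPolygon_convexIndependent (by omega) α, rotatedPolygon_boundary hk α⟩

lemma regularPolygon_eq_rotatedPolygon (k : ℕ) : regularPolygon k = rotatedPolygon k 0 := by
  simp [regularPolygon, rotatedPolygon, circlePoint]

/-! ### Affine images -/

/-- The rotation of the plane by the angle `α`. -/
noncomputable def planeRotation (α : ℝ) : Plane ≃ₗ[ℝ] Plane where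
  toFun z := !₂[z 0 * Real.cos α - z 1 * Real.sin α, z 0 * Real.sin α + z 1 * Real.cos α]
  invFun z := !₂[z 0 * Real.cos α + z 1 * Real.sin α, z 1 * Real.cos α - z 0 * Real.sin α]
  map_add' x y := by
    ext i
    fin_cases i <;> simp <;> ring
  map_smul' c x := by
    ext i
    fin_cases i <;> simp <;> ring
  left_inv z := by
    have h := Real.sin_sq_add_cos_sq α
    ext i
    fin_cases i <;> simp
    · linear_combination z 0 * h
    · linear_combination z 1 * h
  right_inv z := by
    have h := Real.sin_sq_add_cos_sq α
    ext i
    fin_cases i <;> simp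
    · linear_combination z 0 * h
    · linear_combination z 1 * h

lemma planeRotation_circlePoint (α θ : ℝ) :
    planeRotation α (circlePoint θ) = circlePoint (α + θ) := by
  ext i
  fin_cases i
  · simp [planeRotation, circlePoint, Real.cos_add]; ring
  · simp [planeRotation, circlePoint, Real.sin_add]; ring

lemma Polygon.image_boundary (p : Polygon Plane k) (T : Plane ≃ᵃ[ℝ] Plane) :
    T '' p.boundary ℝ = (⟨T ∘ p.vertices⟩ : Polygon Plane k).boundary ℝ := by
  rw [Polygon.boundary, image_iUnion]
  refine iUnion_congr fun i => ?_
  exact affineSegment_image (T : Plane →ᵃ[ℝ] Plane) _ _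

lemma rotatedPolygon_boundary_mem_affineImages (k : ℕ) (α : ℝ) :
    (rotatedPolygon k α).boundary ℝ ∈ affineImages ((regularPolygon k).boundary ℝ) := by
  refine ⟨(planeRotation α).toAffineEquiv, ?_⟩
  rw [Polygon.image_boundary, regularPolygon_eq_rotatedPolygon]
  congr 1
  refine congrArg Polygon.mk (funext fun j => ?_)
  simp [rotatedPolygon, planeRotation_circlePoint]

lemma IsConvexPolygon.map {p : Polygon Plane k} (hp : IsConvexPolygon p)
    (T : Plane ≃ᵃ[ℝ] Plane) : IsConvexPolygon (⟨T ∘ p.vertices⟩ : Polygon Plane k) := by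
  have himg : ∀ s : Set Plane, T '' convexHull ℝ s = convexHull ℝ (T '' s) := fun s =>
    (T : Plane →ᵃ[ℝ] Plane).image_convexHull s
  refine ⟨fun s i hi => ?_, ?_⟩
  · rw [image_comp, ← himg] at hi
    obtain ⟨y, hy, hyi⟩ := hi
    exact hp.1 s i (T.injective hyi ▸ hy)
  · rw [← Polygon.image_boundary, hp.2]
    rw [range_comp, ← himg]
    exact (AffineEquiv.toContinuousAffineEquiv T).toHomeomorph.image_frontier _

lemma affineImages_regularPolygon_subset (hk : 3 ≤ k) :
    affineImages ((regularPolygon k).boundary ℝ) ⊆ convexPolygonCurves k := by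
  rintro _ ⟨T, rfl⟩
  refine ⟨⟨T ∘ (regularPolygon k).vertices⟩, IsConvexPolygon.map ?_ T,
    Polygon.image_boundary _ T⟩
  rw [regularPolygon_eq_rotatedPolygon]
  exact isConvexPolygon_rotatedPolygon hk 0

end

/-! ### The lower bound: evenly turned regular polygons -/

lemma card_le_card_connectedComponents {X Y : Type} [TopologicalSpace X] {W : Set X}
    {f : X → Y} (hf : ∀ x ∈ W, ∀ᶠ y in 𝓝[W] x, f y = f x) {ι : Type} [Fintype ι] (z : ι → X)
    (hz : ∀ i, z i ∈ W) (hinj : Function.Injective fun i => f (z i)) :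
    (Fintype.card ι : ℕ∞) ≤ ENat.card (ConnectedComponents W) := by
  rw [← ENat.card_eq_coe_fintype_card]
  refine ENat.card_le_card_of_injective (f := fun i => ConnectedComponents.mk (⟨z i, hz i⟩ : W)) ?_
  intro i j hij
  apply hinj
  have h1 : (⟨z i, hz i⟩ : W) ∈ connectedComponent (⟨z j, hz j⟩ : W) :=
    ConnectedComponents.coe_eq_coe'.1 hij
  refine (isPreconnected_connectedComponent (x := (⟨z j, hz j⟩ : W))).eq_of_eventually_eq
    (f := fun w : W => f w) (fun w _ => ?_) h1 mem_connectedComponent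
  refine nhdsWithin_le_nhds ?_
  exact eventually_nhds_subtype_iff W w (fun y => f y = f w) |>.2 (hf w w.2)

/-- If one side of an edge line is attained at one direction and exceeded at another one less than
a half turn away, then it is exceeded at all directions between them. -/
lemma lt_heightAlong_between {z : Plane} {θ w A h s : ℝ} (hs : s = 1 ∨ s = -1) (hh : 0 ≤ h)
    (hw : w < Real.pi) (hA : 0 < A) (hAw : A ≤ w) (h₁ : heightAlong θ z = h)
    (h₂ : h < heightAlong (θ + s * w) z) : h < heightAlong (θ + s * A) z := by
  have hsA : 0 < Real.sin A := Real.sin_pos_of_pos_of_lt_pi hA (by linarith)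
  have hsw : 0 < Real.sin w := Real.sin_pos_of_pos_of_lt_pi (by linarith) hw
  have hsB : 0 ≤ Real.sin (w - A) :=
    Real.sin_nonneg_of_nonneg_of_le_pi (by linarith) (by linarith)
  obtain ⟨B, hB⟩ : ∃ B, B = w - A := ⟨_, rfl⟩
  obtain rfl : w = A + B := by linarith
  rw [← hB] at hsB
  -- The height is a sinusoid in the direction, so it is interpolated by sines; $\sin(A+B)\le\sin
  -- A+\sin B$ then preserves the bound.
  have hid : Real.sin (A + B) * heightAlong (θ + s * A) z =
      Real.sin B * heightAlong θ z + Real.sin A * heightAlong (θ + s * (A + B)) z := by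
    have hA2 := Real.sin_sq_add_cos_sq A
    rcases hs with rfl | rfl
    · simp only [heightAlong, one_mul, Real.sin_add, Real.cos_add]
      linear_combination (Real.sin B * (z 0 * Real.cos θ + z 1 * Real.sin θ)) * hA2
    · simp only [heightAlong, neg_mul, one_mul, Real.sin_add, Real.cos_add, Real.sin_neg,
        Real.cos_neg]
      linear_combination (Real.sin B * (z 0 * Real.cos θ + z 1 * Real.sin θ)) * hA2
  have hle : Real.sin (A + B) ≤ Real.sin A + Real.sin B := by
    rw [Real.sin_add]
    nlinarith [Real.cos_le_one A, Real.cos_le_one B]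
  rw [h₁] at hid
  have h3 : Real.sin A * h < Real.sin A * heightAlong (θ + s * (A + B)) z :=
    mul_lt_mul_of_pos_left h₂ hsA
  have h4 : Real.sin (A + B) * h ≤ (Real.sin A + Real.sin B) * h :=
    mul_le_mul_of_nonneg_right hle hh
  exact lt_of_mul_lt_mul_left (by linarith) hsw.le

/-- The normals of the edges of `n` regular `k`-gons, turned successively by `2 * π / (k * n)`. -/
noncomputable def spreadNormal (k n : ℕ) (i : ℤ) : ℝ := 2 * Real.pi / (k * n) * i + Real.pi / k

section

variable {k n : ℕ}

/-- All $kn$ edges are numbered by angle: the residue modulo `n` names the polygon, the quotient its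
edge. -/
lemma edgeNormal_eq_spreadNormal (hn : 0 < n) (l j : ℤ) :
    edgeNormal k (2 * Real.pi / (k * n) * l) j = spreadNormal k n (l + n * j) := by
  have : (n : ℝ) ≠ 0 := by positivity
  rw [edgeNormal, spreadNormal]
  push_cast
  rcases eq_or_ne (k : ℝ) 0 with h | h
  · simp [h]
  · field_simp
    ring

lemma heightAlong_spreadNormal_emod (hk : 0 < k) (hn : 0 < n) (i : ℤ) (z : Plane) :
    heightAlong (spreadNormal k n (i % (k * n : ℕ))) z = heightAlong (spreadNormal k n i) z := by
  rw [← heightAlong_add_two_pi_mul _ (i / (k * n : ℕ))]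
  congr 1
  have h1 : (n : ℝ) ≠ 0 := by positivity
  have h2 : (k : ℝ) ≠ 0 := by positivity
  rw [Int.emod_def, spreadNormal, spreadNormal]
  push_cast
  field_simp
  ring

/-- The drawing of `n` regular `k`-gons, turned successively by `2 * π / (k * n)`. -/
def spreadPolygons (k n : ℕ) : Set Plane :=
  ⋃ c : Fin n, (rotatedPolygon k (2 * Real.pi / (k * n) * ((c : ℕ) : ℤ))).boundary ℝ

lemma mem_spreadPolygons_iff (hk : 3 ≤ k) (hn : 0 < n) (z : Plane) :
    z ∈ spreadPolygons k n ↔ ∃ i : ℤ,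
      (∀ j : ℤ, heightAlong (spreadNormal k n (i + n * j)) z ≤ Real.cos (Real.pi / k)) ∧
        heightAlong (spreadNormal k n i) z = Real.cos (Real.pi / k) := by
  have hn' : (0 : ℤ) < n := by exact_mod_cast hn
  simp only [spreadPolygons, mem_iUnion, mem_rotatedPolygon_boundary_iff hk,
    edgeNormal_eq_spreadNormal hn]
  constructor
  · rintro ⟨c, h1, j, hj⟩
    refine ⟨_, fun j' => ?_, hj⟩
    have := h1 (j + j')
    rwa [mul_add, ← add_assoc] at this
  · rintro ⟨i, h1, h2⟩
    have h3 := Int.emod_lt_of_pos i hn'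
    have h4 := Int.emod_nonneg i hn'.ne'
    have h5 : (((i % n).toNat : ℕ) : ℤ) = i % n := Int.toNat_of_nonneg h4
    refine ⟨⟨(i % n).toNat, by omega⟩, fun j => ?_, i / n, ?_⟩
    · rw [h5]
      have := h1 (j - i / n)
      convert this using 3
      rw [Int.emod_def]; ring
    · rw [h5, Int.emod_add_mul_ediv]
      exact h2

/-- A point on an edge line but outside of the polygon of this edge is outside of all polygons. -/
lemma exists_lt_heightAlong_spreadNormal (hk : 3 ≤ k) (hn : 0 < n) {z : Plane} {i j : ℤ}
    (h₁ : heightAlong (spreadNormal k n i) z = Real.cos (Real.pi / k))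
    (h₂ : Real.cos (Real.pi / k) < heightAlong (spreadNormal k n (i + n * j)) z) (l : ℤ) :
    ∃ j' : ℤ, Real.cos (Real.pi / k) < heightAlong (spreadNormal k n (l + n * j')) z := by
  have hn' : (0 : ℤ) < n := by exact_mod_cast hn
  have hk' : (0 : ℤ) < k := by omega
  have hk0 : (0 : ℝ) < k := by exact_mod_cast hk'
  have hn0 : (0 : ℝ) < n := by exact_mod_cast hn
  have hπ := Real.pi_pos
  have hh := cos_pi_div_pos hk
  set δ := 2 * Real.pi / (k * n) with hδ
  have hδ0 : 0 < δ := by positivity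
  have hN : δ * n * k = 2 * Real.pi := by rw [hδ]; field_simp
  have h3 := Int.emod_lt_of_pos j hk'
  have h4 := Int.emod_nonneg j hk'.ne'
  have hjr : heightAlong (spreadNormal k n (i + n * (j % k))) z =
      heightAlong (spreadNormal k n (i + n * j)) z := by
    rw [← edgeNormal_eq_spreadNormal hn, ← edgeNormal_eq_spreadNormal hn,
      edgeNormal_emod (by omega)]
  rw [← hjr] at h₂
  set r := j % (k : ℤ)
  have hr0 : r ≠ 0 := by
    intro h
    rw [h, mul_zero, add_zero, h₁] at h₂
    exact lt_irrefl _ h₂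
  have hr1 : (1 : ℝ) ≤ r := by
    have : 1 ≤ r := by omega
    exact_mod_cast this
  have hr2 : (r : ℝ) ≤ k - 1 := by
    have : r ≤ k - 1 := by omega
    exact_mod_cast this
  have hsp : ∀ x y : ℤ, spreadNormal k n (x + y) = spreadNormal k n x + δ * y := by
    intro x y
    simp only [spreadNormal]
    push_cast
    ring
  have h₂' := h₂
  rw [hsp] at h₂'
  push_cast at h₂'
  -- If the exceeded edge is less than half a turn ahead, the `n` lines after line `i` are exceeded
  -- too, and they meet every residue modulo `n`. Beyond half a turn the argument is mirrored; at
  -- exactly half a turn the height would be negative.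
  rcases lt_trichotomy (δ * (n * r)) Real.pi with hw | hw | hw
  · have h5 := Int.emod_lt_of_pos (l - i - 1) hn'
    have h6 := Int.emod_nonneg (l - i - 1) hn'.ne'
    have h7 := Int.emod_def (l - i - 1) n
    refine ⟨-((l - i - 1) / n), ?_⟩
    have e : l + n * -((l - i - 1) / n) = i + (1 + (l - i - 1) % n) := by rw [h7]; ring
    rw [e, hsp]
    have h8 : (0 : ℝ) ≤ ((l - i - 1) % n : ℤ) := by exact_mod_cast h6
    have h9 : (((l - i - 1) % n : ℤ) : ℝ) ≤ n - 1 := by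
      have : (l - i - 1) % n ≤ n - 1 := by omega
      exact_mod_cast this
    have := lt_heightAlong_between (s := 1) (A := δ * (1 + (l - i - 1) % n : ℤ)) (Or.inl rfl)
      hh.le hw ?_ ?_ h₁ (by rwa [one_mul])
    · rwa [one_mul] at this
    · push_cast
      positivity
    · push_cast
      refine mul_le_mul_of_nonneg_left ?_ hδ0.le
      nlinarith
  · exfalso
    rw [hw] at h₂'
    simp only [heightAlong, Real.cos_add_pi, Real.sin_add_pi] at h₂' h₁
    linarith
  · have h5 := Int.emod_lt_of_pos (i - 1 - l) hn'
    have h6 := Int.emod_nonneg (i - 1 - l) hn'.ne'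
    have h7 := Int.emod_def (i - 1 - l) n
    refine ⟨(i - 1 - l) / n, ?_⟩
    have e : l + n * ((i - 1 - l) / n) = i + -(1 + (i - 1 - l) % n) := by rw [h7]; ring
    rw [e, hsp]
    have h8 : (0 : ℝ) ≤ ((i - 1 - l) % n : ℤ) := by exact_mod_cast h6
    have h9 : (((i - 1 - l) % n : ℤ) : ℝ) ≤ n - 1 := by
      have : (i - 1 - l) % n ≤ n - 1 := by omega
      exact_mod_cast this
    have := lt_heightAlong_between (s := -1) (A := δ * (1 + (i - 1 - l) % n : ℤ))
      (w := 2 * Real.pi - δ * (n * r)) (Or.inr rfl) hh.le (by linarith) ?_ ?_ h₁ ?_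
    · convert this using 2
      push_cast
      ring
    · push_cast
      positivity
    · push_cast
      rw [← hN]
      have : δ * (1 + (((i - 1 - l) % n : ℤ) : ℝ)) ≤ δ * n :=
        mul_le_mul_of_nonneg_left (by linarith) hδ0.le
      have h10 : δ * n * 1 ≤ δ * n * (k - r) :=
        mul_le_mul_of_nonneg_left (by linarith) (by positivity)
      linarith
    · rw [← heightAlong_add_two_pi_mul _ (-1)] at h₂'
      convert h₂' using 2
      push_cast
      ring

open Classical in
/-- The edge lines that separate a point from the centre, unless the point is outside of all
polygons. -/
noncomputable def spreadSignature (k n : ℕ) (z : Plane) : Option (Set ℤ) :=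
  if ∃ l : ℤ, ∀ j : ℤ, heightAlong (spreadNormal k n (l + n * j)) z < Real.cos (Real.pi / k) then
    some {i | Real.cos (Real.pi / k) < heightAlong (spreadNormal k n i) z} else none

/-- A point off the drawing but on an edge line is outside that edge's polygon, hence outside all.
So a point strictly inside some polygon is on no edge line, and a point strictly inside none is
strictly outside each. -/
lemma eventually_spreadSignature_eq (hk : 3 ≤ k) (hn : 0 < n) {z : Plane}
    (hz : z ∉ spreadPolygons k n) :
    ∀ᶠ y in 𝓝 z, spreadSignature k n y = spreadSignature k n z := by
  have hk0 : 0 < k := by omega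
  have hn' : (0 : ℤ) < n := by exact_mod_cast hn
  have hN : (0 : ℤ) < (k * n : ℕ) := by exact_mod_cast Nat.mul_pos hk0 hn
  have hz' : ∀ i : ℤ, heightAlong (spreadNormal k n i) z = Real.cos (Real.pi / k) →
      ∃ j : ℤ, Real.cos (Real.pi / k) < heightAlong (spreadNormal k n (i + n * j)) z := by
    intro i hi
    by_contra! h
    exact hz ((mem_spreadPolygons_iff hk hn z).2 ⟨i, h, hi⟩)
  by_cases hD : ∃ l : ℤ, ∀ j : ℤ,
      heightAlong (spreadNormal k n (l + n * j)) z < Real.cos (Real.pi / k)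
  · have hDy : ∀ᶠ y in 𝓝 z, ∃ l : ℤ, ∀ j : ℤ,
        heightAlong (spreadNormal k n (l + n * j)) y < Real.cos (Real.pi / k) := by
      obtain ⟨l, hl⟩ := hD
      simp only [← edgeNormal_eq_spreadNormal hn] at hl
      filter_upwards [(isOpen_setOf_forall_heightAlong_lt hk0 _ _).mem_nhds hl] with y hy
      refine ⟨l, ?_⟩
      simpa only [← edgeNormal_eq_spreadNormal hn] using hy
    have hne : ∀ i : ℤ, heightAlong (spreadNormal k n i) z ≠ Real.cos (Real.pi / k) := by
      intro i hi
      obtain ⟨j, hj⟩ := hz' i hi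
      obtain ⟨l, hl⟩ := hD
      obtain ⟨j', hj'⟩ := exists_lt_heightAlong_spreadNormal hk hn hi hj l
      exact (hl j').not_gt hj'
    have hloc : ∀ i : ℤ, ∀ᶠ y in 𝓝 z, (Real.cos (Real.pi / k) < heightAlong (spreadNormal k n i) y ↔
        Real.cos (Real.pi / k) < heightAlong (spreadNormal k n i) z) := by
      intro i
      have hcont := (continuous_heightAlong (spreadNormal k n i)).continuousAt (x := z)
      rcases lt_or_gt_of_ne (hne i) with h | h
      · filter_upwards [hcont.eventually_lt_const h] with y hy
        exact ⟨fun h' => absurd h' hy.not_gt, fun h' => absurd h' h.not_gt⟩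
      · filter_upwards [hcont.eventually_const_lt h] with y hy
        exact ⟨fun _ => h, fun _ => hy⟩
    have hall : ∀ᶠ y in 𝓝 z, ∀ i ∈ Finset.Ico (0 : ℤ) (k * n : ℕ),
        (Real.cos (Real.pi / k) < heightAlong (spreadNormal k n i) y ↔
        Real.cos (Real.pi / k) < heightAlong (spreadNormal k n i) z) :=
      (Finset.eventually_all _).2 fun i _ => hloc i
    filter_upwards [hDy, hall] with y hy1 hy2
    rw [spreadSignature, spreadSignature, if_pos hy1, if_pos hD]
    congr 1
    ext i
    have := hy2 (i % (k * n : ℕ))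
      (Finset.mem_Ico.2 ⟨Int.emod_nonneg _ hN.ne', Int.emod_lt_of_pos _ hN⟩)
    rwa [heightAlong_spreadNormal_emod hk0 hn, heightAlong_spreadNormal_emod hk0 hn] at this
  · have hlt : ∀ l : ℤ, ∃ j : ℤ,
        Real.cos (Real.pi / k) < heightAlong (spreadNormal k n (l + n * j)) z := by
      intro l
      push Not at hD
      obtain ⟨j, hj⟩ := hD l
      rcases hj.lt_or_eq with h | h
      · exact ⟨j, h⟩
      · obtain ⟨j', hj'⟩ := hz' _ h.symm
        refine ⟨j + j', ?_⟩
        rwa [mul_add, ← add_assoc]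
    have hall : ∀ᶠ y in 𝓝 z, ∀ l ∈ Finset.Ico (0 : ℤ) n, ∃ j : ℤ,
        Real.cos (Real.pi / k) < heightAlong (spreadNormal k n (l + n * j)) y := by
      refine (Finset.eventually_all _).2 fun l _ => ?_
      obtain ⟨j, hj⟩ := hlt l
      filter_upwards [(continuous_heightAlong _).continuousAt.eventually_const_lt hj] with y hy
      exact ⟨j, hy⟩
    filter_upwards [hall] with y hy
    rw [spreadSignature, spreadSignature, if_neg hD, if_neg]
    rintro ⟨l, hl⟩
    obtain ⟨j, hj⟩ := hy (l % n) (Finset.mem_Ico.2 ⟨Int.emod_nonneg _ hn'.ne',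
      Int.emod_lt_of_pos _ hn'⟩)
    have := hl (j - l / n)
    have e : l + n * (j - l / n) = l % n + n * j := by rw [Int.emod_def]; ring
    rw [e] at this
    exact this.not_gt hj

/-- A point which exactly the `m` edge lines from the `a`-th one onwards separate from the
centre. -/
noncomputable def spreadPoint (k n : ℕ) (a m : ℤ) : Plane :=
  (Real.cos (Real.pi / k) / Real.cos (2 * Real.pi / (k * n) * m / 2)) •
    circlePoint (spreadNormal k n a + 2 * Real.pi / (k * n) * ((m - 1) / 2))

/-- With $\delta=2\pi/(kn)$, the normals of the block are within $\delta(m-1)/2$ of the direction of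
the point, all others at least $\delta(m+1)/2$ away; the radius puts the threshold at $\delta m/2$.
-/
lemma heightAlong_spreadPoint (hk : 3 ≤ k) (hn : 0 < n) {a m : ℤ} (hm : 0 < m) (hmn : m < n)
    (i : ℤ) :
    ((i - a) % (k * n : ℕ) < m ∧
      Real.cos (Real.pi / k) < heightAlong (spreadNormal k n i) (spreadPoint k n a m)) ∨
    (m ≤ (i - a) % (k * n : ℕ) ∧
      heightAlong (spreadNormal k n i) (spreadPoint k n a m) < Real.cos (Real.pi / k)) := by
  have hk0 : 0 < k := by omega
  have hkR : (3 : ℝ) ≤ k := by exact_mod_cast hk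
  have hkR0 : (0 : ℝ) < k := by linarith
  have hn0 : (0 : ℝ) < n := by exact_mod_cast hn
  have hN : (0 : ℤ) < (k * n : ℕ) := by exact_mod_cast Nat.mul_pos hk0 hn
  have hπ := Real.pi_pos
  have hh := cos_pi_div_pos hk
  have h1 := Int.emod_lt_of_pos (i - a) hN
  have h2 := Int.emod_nonneg (i - a) hN.ne'
  have h3 := Int.emod_def (i - a) (k * n : ℕ)
  have e1 : heightAlong (spreadNormal k n i) (spreadPoint k n a m) =
      heightAlong (spreadNormal k n (a + (i - a) % (k * n : ℕ))) (spreadPoint k n a m) := by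
    rw [← heightAlong_spreadNormal_emod hk0 hn i,
      ← heightAlong_spreadNormal_emod hk0 hn (a + (i - a) % (k * n : ℕ))]
    congr 2
    simp
  rw [e1]
  set r := (i - a) % ((k * n : ℕ) : ℤ)
  set δ := 2 * Real.pi / (k * n) with hδ
  have hδ0 : 0 < δ := by positivity
  have hδN : δ * n * k = 2 * Real.pi := by rw [hδ]; field_simp
  have hmR : (1 : ℝ) ≤ m := by exact_mod_cast hm
  have hmR' : (m : ℝ) ≤ n - 1 := by
    have : m ≤ n - 1 := by omega
    exact_mod_cast this
  have hrR : (0 : ℝ) ≤ r := by exact_mod_cast h2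
  have hrR' : (r : ℝ) ≤ k * n - 1 := by
    have : r ≤ (k * n : ℕ) - 1 := by omega
    exact_mod_cast this
  have hδn : δ * n ≤ 2 * Real.pi / 3 := by nlinarith
  have hδm : δ * m + δ ≤ δ * n := by nlinarith
  have hδm0 : 0 < δ * m := by positivity
  have hcm : 0 < Real.cos (δ * m / 2) := Real.cos_pos_of_mem_Ioo ⟨by linarith, by linarith⟩
  have e2 : heightAlong (spreadNormal k n (a + r)) (spreadPoint k n a m) =
      Real.cos (Real.pi / k) / Real.cos (δ * m / 2) * Real.cos (δ * (r - (m - 1) / 2)) := by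
    rw [spreadPoint, (isLinearMap_heightAlong _).map_smul, heightAlong_circlePoint, smul_eq_mul,
      ← Real.cos_neg (δ * (r - (m - 1) / 2))]
    congr 2
    simp only [spreadNormal]
    push_cast
    ring
  rw [e2, div_mul_eq_mul_div, lt_div_iff₀ hcm, div_lt_iff₀ hcm, mul_lt_mul_iff_right₀ hh,
    mul_lt_mul_iff_right₀ hh]
  rcases lt_or_ge r m with h | h
  · left
    refine ⟨h, ?_⟩
    have h' : (r : ℝ) ≤ m - 1 := by
      have : r ≤ m - 1 := by omega
      exact_mod_cast this
    rw [← Real.cos_abs (δ * (r - (m - 1) / 2))]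
    refine Real.cos_lt_cos_of_nonneg_of_le_pi (abs_nonneg _) (by linarith) ?_
    rw [abs_lt]
    constructor <;> nlinarith
  · right
    refine ⟨h, ?_⟩
    have h' : (m : ℝ) ≤ r := by exact_mod_cast h
    have h5 : Real.cos (δ * (r - (m - 1) / 2)) ≤ Real.cos (δ * (m + 1) / 2) := by
      refine Real.cos_le_cos_of_mem_Icc (by positivity) ⟨?_, ?_⟩
      · nlinarith
      · rw [← hδN]
        nlinarith
    refine h5.trans_lt (Real.cos_lt_cos_of_nonneg_of_le_pi (by positivity) ?_ ?_)
    · linarith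
    · linarith

lemma heightAlong_spreadPoint_ne (hk : 3 ≤ k) (hn : 0 < n) {a m : ℤ} (hm : 0 < m) (hmn : m < n)
    (i : ℤ) :
    heightAlong (spreadNormal k n i) (spreadPoint k n a m) ≠ Real.cos (Real.pi / k) := by
  rcases heightAlong_spreadPoint hk hn (a := a) hm hmn i with h | h
  · exact h.2.ne'
  · exact h.2.ne

lemma spreadSignature_spreadPoint (hk : 3 ≤ k) (hn : 0 < n) {a m : ℤ} (hm : 0 < m) (hmn : m < n) :
    spreadSignature k n (spreadPoint k n a m) = some {i | (i - a) % (k * n : ℕ) < m} := by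
  have hN : (0 : ℤ) < (k * n : ℕ) := by exact_mod_cast Nat.mul_pos (by omega : 0 < k) hn
  rw [spreadSignature, if_pos]
  · congr 1
    ext i
    rcases heightAlong_spreadPoint hk hn (a := a) hm hmn i with h | h
    · exact ⟨fun _ => h.1, fun _ => h.2⟩
    · exact ⟨fun h' => absurd h' h.2.not_gt, fun h' => absurd h' (not_lt.2 h.1)⟩
  -- As $m<n$, the block contains no line of the polygon of `a + m`, so the point is inside that
  -- polygon.
  · refine ⟨a + m, fun j => ?_⟩
    rcases heightAlong_spreadPoint hk hn (a := a) hm hmn (a + m + n * j) with h | h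
    · exfalso
      have h1 : (a + m + n * j - a) % ((k * n : ℕ) : ℤ) % n = m := by
        rw [Int.emod_emod_of_dvd _ (by exact_mod_cast dvd_mul_left n k)]
        have : a + m + n * j - a = m + n * j := by ring
        rw [this, Int.add_mul_emod_self_left, Int.emod_eq_of_lt hm.le hmn]
      have h2 := Int.emod_nonneg (a + m + n * j - a) hN.ne'
      rw [Int.emod_eq_of_lt h2 (h.1.trans hmn)] at h1
      omega
    · exact h.2

/-- A proper cyclic block has only one member whose predecessor is missing, its start; the first
missing index after it fixes the length. -/
lemma setOf_emod_lt_injective {N a a' m m' : ℤ} (ha : 0 ≤ a) (haN : a < N) (ha' : 0 ≤ a')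
    (haN' : a' < N) (hm : 0 < m) (hmN : m < N) (hm' : 0 < m') (hmN' : m' < N)
    (h : {i : ℤ | (i - a) % N < m} = {i | (i - a') % N < m'}) : a = a' ∧ m = m' := by
  have hiff : ∀ i : ℤ, (i - a) % N < m ↔ (i - a') % N < m' := fun i => by
    have := Set.ext_iff.1 h i
    exact this
  have hN : 0 < N := by omega
  have h1 := (hiff a).1 (by simpa using hm)
  have h2 : ¬ (a - 1 - a) % N < m := by
    have : a - 1 - a = (N - 1) - N := by ring
    rw [this, Int.sub_emod_right, Int.emod_eq_of_lt (by omega) (by omega)]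
    omega
  rw [hiff] at h2
  have haa : a = a' := by
    rcases lt_trichotomy a a' with h3 | h3 | h3
    · have e1 : (a - a') % N = a - a' + N := by
        rw [← Int.add_emod_right, Int.emod_eq_of_lt (by omega) (by omega)]
      have e2 : (a - 1 - a') % N = a - 1 - a' + N := by
        rw [← Int.add_emod_right, Int.emod_eq_of_lt (by omega) (by omega)]
      omega
    · exact h3
    · rw [Int.emod_eq_of_lt (by omega) (by omega)] at h1 h2
      omega
  subst haa
  refine ⟨rfl, ?_⟩
  have h3 := hiff (a + m)
  have h4 := hiff (a + m')
  simp only [add_sub_cancel_left] at h3 h4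
  rw [Int.emod_eq_of_lt hm.le hmN] at h3
  rw [Int.emod_eq_of_lt hm'.le hmN'] at h4
  omega

/-- Every regular polygon of the drawing is exceeded at a far point. -/
lemma exists_lt_heightAlong_far (hk : 3 ≤ k) (hn : 0 < n) (l : ℤ) : ∃ j : ℤ,
    Real.cos (Real.pi / k) <
      heightAlong (spreadNormal k n (l + n * j)) ((2 : ℝ) • circlePoint 0) := by
  have hkR : (3 : ℝ) ≤ k := by exact_mod_cast hk
  have hkR0 : (0 : ℝ) < k := by linarith
  have hn0 : (0 : ℝ) < n := by exact_mod_cast hn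
  have hπ := Real.pi_pos
  have hh := cos_pi_div_pos hk
  set w := 2 * Real.pi / k with hw
  have hw0 : 0 < w := by positivity
  have h1 := abs_sub_round (spreadNormal k n l / w)
  -- Rounding picks the normal of polygon `l` nearest to direction 0, at most $\pi/k$ away, so the
  -- height is at least $2\cos(\pi/k)$.
  refine ⟨-round (spreadNormal k n l / w), ?_⟩
  set q := round (spreadNormal k n l / w)
  have e : spreadNormal k n (l + n * -q) = (spreadNormal k n l / w - q) * w := by
    rw [sub_mul, div_mul_cancel₀ _ hw0.ne', spreadNormal, spreadNormal, hw]
    push_cast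
    field_simp
    ring
  rw [(isLinearMap_heightAlong _).map_smul, heightAlong_circlePoint, smul_eq_mul, zero_sub,
    Real.cos_neg, e,
    ← Real.cos_abs ((_ - _) * w), abs_mul, abs_of_pos hw0]
  have h2 : |spreadNormal k n l / w - q| * w ≤ Real.pi / k := by
    have : Real.pi / k = 1 / 2 * w := by rw [hw]; ring
    rw [this]
    exact mul_le_mul_of_nonneg_right h1 hw0.le
  have h3 := Real.cos_le_cos_of_nonneg_of_le_pi (by positivity)
    (div_le_self hπ.le (by linarith)) h2
  linarith

lemma le_numRegions_spreadPolygons (hk : 3 ≤ k) (hn : 0 < n) :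
    ((k * n ^ 2 - k * n + 2 : ℕ) : ℕ∞) ≤ numRegions (spreadPolygons k n) := by
  have hk0 : 0 < k := by omega
  have hh := cos_pi_div_pos hk
  -- One far point, the centre, and $kn(n-1)$ block points; the block length is shifted by one to
  -- run over $1,\dots,n-1$.
  let z : Option (Option (Fin (k * n) × Fin (n - 1))) → Plane
    | none => (2 : ℝ) • circlePoint 0
    | some none => 0
    | some (some (a, m)) => spreadPoint k n (a : ℕ) ((m : ℕ) + 1)
  have h0 : ∀ i, heightAlong (spreadNormal k n i) 0 = 0 := fun i => by simp [heightAlong]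
  have hm : ∀ m : Fin (n - 1), (0 : ℤ) < (m : ℕ) + 1 ∧ ((m : ℕ) + 1 : ℤ) < n := fun m => by
    have := m.2
    omega
  have hz : ∀ i, z i ∈ (spreadPolygons k n)ᶜ := by
    intro i hi
    obtain ⟨l, h1, h2⟩ := (mem_spreadPolygons_iff hk hn _).1 hi
    match i with
    | none =>
      obtain ⟨j, hj⟩ := exists_lt_heightAlong_far hk hn l
      exact (h1 j).not_gt hj
    | some none =>
      have : heightAlong (spreadNormal k n l) 0 = Real.cos (Real.pi / k) := h2
      rw [h0] at this
      exact hh.ne this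
    | some (some (a, m)) =>
      exact heightAlong_spreadPoint_ne hk hn (hm m).1 (hm m).2 l h2
  have s1 : spreadSignature k n (z none) = none := by
    rw [spreadSignature, if_neg]
    rintro ⟨l, hl⟩
    obtain ⟨j, hj⟩ := exists_lt_heightAlong_far hk hn l
    exact (hl j).not_gt hj
  have s2 : spreadSignature k n (z (some none)) = some ∅ := by
    have : z (some none) = 0 := rfl
    rw [this, spreadSignature, if_pos ⟨0, fun j => by rw [h0]; exact hh⟩]
    congr 1
    ext i
    simp [h0, hh.le]
  have s3 : ∀ a m, spreadSignature k n (z (some (some (a, m)))) =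
      some {i | (i - (a : ℕ)) % (k * n : ℕ) < ((m : ℕ) + 1 : ℤ)} := fun a m =>
    spreadSignature_spreadPoint hk hn (hm m).1 (hm m).2
  have hne : ∀ (a : Fin (k * n)) (m : Fin (n - 1)),
      {i : ℤ | (i - (a : ℕ)) % (k * n : ℕ) < ((m : ℕ) + 1 : ℤ)} ≠ ∅ := by
    intro a m h
    have : ((a : ℕ) : ℤ) ∈ {i : ℤ | (i - (a : ℕ)) % (k * n : ℕ) < ((m : ℕ) + 1 : ℤ)} := by
      simp only [mem_ofPred_eq, sub_self, Int.zero_emod]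
      exact (hm m).1
    rw [h] at this
    exact this
  have hinj : Function.Injective fun i => spreadSignature k n (z i) := by
    rintro (_ | _ | ⟨a, m⟩) (_ | _ | ⟨a', m'⟩) h <;> simp only [s1, s2, s3] at h
    · rfl
    · simp at h
    · simp at h
    · simp at h
    · rfl
    · exact absurd (Option.some_injective _ h).symm (hne a' m')
    · simp at h
    · exact absurd (Option.some_injective _ h) (hne a m)
    · have hnk : (n : ℤ) ≤ (k * n : ℕ) := by exact_mod_cast Nat.le_mul_of_pos_left n hk0
      have h1 := hm m
      have h2 := hm m'
      have h3 : (((a : ℕ) : ℤ)) < (k * n : ℕ) := by exact_mod_cast a.2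
      have h4 : (((a' : ℕ) : ℤ)) < (k * n : ℕ) := by exact_mod_cast a'.2
      obtain ⟨h5, h6⟩ := setOf_emod_lt_injective (by positivity) h3 (by positivity) h4
        h1.1 (by linarith) h2.1 (by linarith) (Option.some_injective _ h)
      have h7 : a = a' := Fin.ext (by exact_mod_cast h5)
      have h8 : m = m' := Fin.ext (by
        have : ((m : ℕ) : ℤ) = (m' : ℕ) := by linarith
        exact_mod_cast this)
      rw [h7, h8]
  refine le_trans ?_ (card_le_card_connectedComponents (f := spreadSignature k n)
    (fun x hx => nhdsWithin_le_nhds (eventually_spreadSignature_eq hk hn hx)) z hz hinj)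
  rw [Nat.cast_le]
  simp only [Fintype.card_option, Fintype.card_prod, Fintype.card_fin]
  rw [Nat.mul_sub, mul_one]
  have : k * n * n = k * n ^ 2 := by ring
  rw [this]

end

theorem mainTheorem9 (k : ℕ) (hk : 3 ≤ k) :
    (IsGreatest (regionNumbers (convexPolygonCurves k) 0) 1 ∧
      ∀ n : ℕ, 1 ≤ n →
        IsGreatest (regionNumbers (convexPolygonCurves k) n)
          ((k * n ^ 2 - k * n + 2 : ℕ) : ℕ∞)) ∧
    (IsGreatest (regionNumbers (affineImages ((regularPolygon k).boundary ℝ)) 0) 1 ∧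
      ∀ n : ℕ, 1 ≤ n →
        IsGreatest (regionNumbers (affineImages ((regularPolygon k).boundary ℝ)) n)
          ((k * n ^ 2 - k * n + 2 : ℕ) : ℕ∞)) := by
  have hsub := affineImages_regularPolygon_subset hk
  have hmono : ∀ n, regionNumbers (affineImages ((regularPolygon k).boundary ℝ)) n ⊆
      regionNumbers (convexPolygonCurves k) n := by
    rintro n _ ⟨c, hc, rfl⟩
    exact ⟨c, fun i => hsub (hc i), rfl⟩
  have hupper : ∀ n : ℕ, 1 ≤ n → ((k * n ^ 2 - k * n + 2 : ℕ) : ℕ∞) ∈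
      upperBounds (regionNumbers (convexPolygonCurves k) n) := by
    rintro n hn _ ⟨c, hc, rfl⟩
    simpa [show n ≠ 0 by omega] using numRegions_le_of_convexPolygonCurves hk n c hc
  have hmem : ∀ n : ℕ, 1 ≤ n → ((k * n ^ 2 - k * n + 2 : ℕ) : ℕ∞) ∈
      regionNumbers (affineImages ((regularPolygon k).boundary ℝ)) n := by
    intro n hn
    have hc : ∀ c : Fin n, (rotatedPolygon k (2 * Real.pi / (k * n) * ((c : ℕ) : ℤ))).boundary ℝ ∈
        affineImages ((regularPolygon k).boundary ℝ) := fun c =>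
      rotatedPolygon_boundary_mem_affineImages k _
    exact ⟨_, hc, le_antisymm (le_numRegions_spreadPolygons hk hn)
      (hupper n hn ⟨_, fun i => hsub (hc i), rfl⟩)⟩
  refine ⟨⟨?_, fun n hn => ⟨hmono n (hmem n hn), hupper n hn⟩⟩, ?_,
    fun n hn => ⟨hmem n hn, fun r hr => hupper n hn (hmono n hr)⟩⟩
  all_goals
    rw [regionNumbers_zero]
    exact isGreatest_singleton
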